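/- Let $d\in\mathbb N$ and $\mathbb R_*=\mathbb R\setminus\{0\}$. Let $\mathscr D(\mathbb R^d)$ be the space of complex-valued test functions (smooth, compactly supported) with its usual LF topology, and $\mathscr D'(\mathbb R^d)$ the space of distributions with its strong topology, i.e. that of uniform convergence on the bounded (equivalently, on the compact) subsets of $\mathscr D(\mathbb R^d)$. Let $\mathscr E'(\mathbb R^d)$ be the space of compactly supported distributions, which act on all smooth functions on $\mathbb R^d$, and $\mathscr E'(\mathbb R_*^d)$ the space of distributions whose support is a compact subset of $\mathbb R_*^d$, which act on all smooth functions on $\mathbb R_*^d$. Write $xy=(x_1y_1,\dots,x_dy_d)$. A Hadamard operator is a continuous linear operator $L$ on $\mathscr D'(\mathbb R^d)$ such that for every $\alpha\in\mathbb N_0^d$ there is $m_\alpha\in\mathbb C$ with $L(x^\alpha)=m_\alpha x^\alpha$; $\mathscr M(\mathbb R^d)$ is the set of Hadamard operators, and the $m_\alpha$ are the eigenvalues of $L$. For $T\in\mathscr E'(\mathbb R^d)$ let $N_T:\mathscr E'(\mathbb R^d)\to\mathscr E'(\mathbb R^d)$ be the map $N_T(S)=S\star T$, where $(S\star T)(f)=S_y\big(T_x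 f(xy)\big)$ for smooth $f$. Let $\mathscr D_H$ be the set of all $T\in\mathscr D'(\mathbb R^d)$ such that for every $\varphi\in\mathscr D(\mathbb R^d)$ the function $y\mapsto T_x\varphi(xy)$, $y\in\mathbb R_*^d$, is the restriction of a (necessarily unique) function $M_T\varphi\in\mathscr D(\mathbb R^d)$. For $T\in\mathscr D_H$ and $S\in\mathscr D'(\mathbb R^d)$ put $L_T(S)(\varphi)=S(M_T\varphi)$, $\varphi\in\mathscr D(\mathbb R^d)$. **Theorem.** For $T\in\mathscr D'(\mathbb R^d)$ the following are equivalent: 1. $T\in\mathscr E'(\mathbb R^d)$ and $N_T$ extends to an operator in $\mathscr M(\mathbb R^d)$, i.e. there is $L\in\mathscr M(\mathbb R^d)$ with $L(S)=N_T(S)$ for all $S\in\mathscr E'(\mathbb R^d)$. 2. $T\in\mathscr D_H$ and $L_T$ maps $\mathscr E'(\mathbb R^d)$ into $\mathscr E'(\mathbb R^d)$. 3. $T\in\mathscr E'(\mathbb R_*^d)$. In this case, with $\sigma(x)=\prod_j x_j/|x_j|$, $\mathbf 1=(1,\dots,1)$ and $$m_\alpha=T_x\Big(\frac{\sigma(x)}{x^{\alpha+\mathbf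 1}}\Big),\qquad \alpha\in\mathbb N_0^d,$$ every $L\in\mathscr M(\mathbb R^d)$ that extends $N_T$ satisfies $L(x^\alpha)=m_\alpha x^\alpha$ for all $\alpha$, and likewise $L_T(x^\alpha)=m_\alpha x^\alpha$ for all $\alpha$. -/

import Mathlib

open scoped Distributions CompactConvergenceCLM Topology

namespace Hadamard

/-- The space `𝓓(ℝ^d)` of complex-valued test functions on `ℝ^d`, with its LF topology. The product
`x * y` of two points of `Fin d → ℝ` is the coordinatewise product. -/
abbrev Test (d : ℕ) : Type := 𝓓((⊤ : TopologicalSpace.Opens (Fin d → ℝ)), ℂ)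

/-- The space `𝓓'(ℝ^d)` of complex distributions, i.e. of continuous `ℂ`-linear functionals on
`𝓓(ℝ^d)`, with the topology of uniform convergence on compact sets (which is that of uniform
convergence on bounded sets, as `𝓓(ℝ^d)` is a Montel space). -/
abbrev Distr (d : ℕ) : Type := Test d →L_c[ℂ] ℂ

/-- `(ℝ \ {0})^d`. -/
def Rstar (d : ℕ) : Set (Fin d → ℝ) := {x | ∀ j, x j ≠ 0}

/-- The support of a distribution. -/
def supp {d : ℕ} (T : Distr d) : Set (Fin d → ℝ) := Distribution.dsupport (T : Test d → ℂ)

/-- `𝓔'(ℝ^d)`, as the set of the compactly supported elements of `𝓓'(ℝ^d)`. -/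
def EPrime (d : ℕ) : Set (Distr d) := {T | IsCompact (supp T)}

/-- `𝓔'((ℝ \ {0})^d)`, as the set of the elements of `𝓓'(ℝ^d)` whose support is a compact subset
of `(ℝ \ {0})^d`. -/
def EPrimeStar (d : ℕ) : Set (Distr d) := {T | IsCompact (supp T) ∧ supp T ⊆ Rstar d}

open Classical in
/-- The value `T(f)` of a compactly supported distribution `T` at a function `f` that is smooth on
a neighbourhood of `supp T`: it is `T(ψ)` for any test function `ψ` which agrees with `f` on a
neighbourhood of `supp T`. -/
noncomputable def pairing {d : ℕ} (T : Distr d) (f : (Fin d → ℝ) → ℂ) : ℂ :=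
  if h : ∃ ψ : Test d, f =ᶠ[𝓝ˢ (supp T)] (ψ : (Fin d → ℝ) → ℂ) then T h.choose else 0

/-- The product of a smooth function and a test function is a test function. -/
theorem exists_smul {d : ℕ} {χ : (Fin d → ℝ) → ℝ}
    (hχ : ContDiff ℝ ((⊤ : ℕ∞) : WithTop ℕ∞) χ) (u : Test d) :
    ∃ w : Test d, ⇑w = fun x => χ x • u x :=
  ⟨⟨fun x => χ x • u x, hχ.smul u.contDiff,
    HasCompactSupport.smul_left (f := χ) (f' := u) u.hasCompactSupport, Set.subset_univ _⟩, rfl⟩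

/-- A distribution vanishes at the test functions that vanish near its support. -/
theorem apply_eq_zero {d : ℕ} (T : Distr d) (u : Test d)
    (hu : Disjoint (tsupport u) (supp T)) : T u = 0 := by
  have hK : IsCompact (tsupport u) := u.hasCompactSupport
  have hloc : ∀ x : tsupport u, ∃ s : Set (Fin d → ℝ),
      Distribution.IsVanishingOn (T : Test d → ℂ) s ∧ IsOpen s ∧ (x : Fin d → ℝ) ∈ s := fun x =>
    (Distribution.notMem_dsupport_iff _).1 (Set.disjoint_left.1 hu x.2)
  choose U hU hUo hxU using hloc
  obtain ⟨t, ht⟩ := hK.elim_finite_subcover U hUo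
    (fun x hx => Set.mem_iUnion.2 ⟨⟨x, hx⟩, hxU _⟩)
  obtain ⟨ρ, hρ⟩ := SmoothPartitionOfUnity.exists_isSubordinate
    (modelWithCornersSelf ℝ (Fin d → ℝ)) (isClosed_tsupport u)
    (fun i : t => U i) (fun i => hUo i) (by simpa [Set.iUnion_subtype] using ht)
  have hex : ∀ i : t, ∃ w : Test d, ⇑w = fun x => ρ i x • u x :=
    fun i => exists_smul (contMDiff_iff_contDiff.1 (ρ i).contMDiff) u
  choose w hwx using hex
  have hw : u = ∑ i, w i := by
    ext x
    have hs : (∑ i, w i) x = ∑ i, w i x :=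
      map_sum (AddMonoidHom.mk' (fun v : Test d => v x) fun _ _ => rfl) w Finset.univ
    simp only [hs, hwx]
    rw [← Finset.sum_smul]
    by_cases hx : x ∈ tsupport u
    · have h1 := ρ.sum_eq_one hx
      rw [finsum_eq_sum_of_fintype] at h1
      rw [h1, one_smul]
    · rw [image_eq_zero_of_notMem_tsupport hx, smul_zero]
  rw [hw, map_sum]
  refine Finset.sum_eq_zero fun i _ => hU i _ ?_
  rw [hwx]
  exact (tsupport_smul_subset_left (fun x => ρ i x) u).trans (hρ i)

/-- The value `T(f)` does not depend on the chosen test function. -/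
theorem pairing_eq {d : ℕ} (T : Distr d) (f : (Fin d → ℝ) → ℂ) (ψ : Test d)
    (h : f =ᶠ[𝓝ˢ (supp T)] (ψ : (Fin d → ℝ) → ℂ)) : pairing T f = T ψ := by
  have hex : ∃ ψ : Test d, f =ᶠ[𝓝ˢ (supp T)] (ψ : (Fin d → ℝ) → ℂ) := ⟨ψ, h⟩
  rw [pairing, dif_pos hex, ← sub_eq_zero, ← map_sub]
  refine apply_eq_zero T _ (Set.disjoint_right.2 fun x hx => ?_)
  rw [notMem_tsupport_iff_eventuallyEq]
  filter_upwards [(hex.choose_spec.symm.trans h).filter_mono (nhds_le_nhdsSet hx)] with y hy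
  simp [hy]

/-- If `f` is smooth near the compact support of `T`, then `T(f)` is given by a test function. -/
theorem exists_test {d : ℕ} (T : Distr d) (hT : IsCompact (supp T)) (f : (Fin d → ℝ) → ℂ)
    {U : Set (Fin d → ℝ)} (hU : IsOpen U) (hTU : supp T ⊆ U)
    (hf : ContDiffOn ℝ ((⊤ : ℕ∞) : WithTop ℕ∞) f U) :
    ∃ ψ : Test d, f =ᶠ[𝓝ˢ (supp T)] (ψ : (Fin d → ℝ) → ℂ) := by
  obtain ⟨K, hK, hTK, hKU⟩ := exists_compact_between hT hU hTU
  obtain ⟨χ, h1, h0, -⟩ := exists_contMDiffMap_one_nhds_of_subset_interior (n := (⊤ : ℕ∞))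
    (modelWithCornersSelf ℝ (Fin d → ℝ)) hT.isClosed hTK
  have hsupp : tsupport (fun x => (χ x : ℝ) • f x) ⊆ K := by
    refine closure_minimal (fun x hx => ?_) hK.isClosed
    by_contra hxK
    exact hx (by simp [h0 x hxK])
  refine ⟨⟨fun x => (χ x : ℝ) • f x, ?_, hK.of_isClosed_subset (isClosed_tsupport _) hsupp,
    by simp⟩, ?_⟩
  · refine contDiff_iff_contDiffAt.2 fun x => ?_
    by_cases hx : x ∈ tsupport (fun x => (χ x : ℝ) • f x)
    · exact ContDiffAt.smul χ.contMDiff.contDiff.contDiffAt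
        (hf.contDiffAt (hU.mem_nhds (hKU (hsupp hx))))
    · exact contDiffAt_const.congr_of_eventuallyEq (notMem_tsupport_iff_eventuallyEq.1 hx)
  · filter_upwards [h1] with x hx
    simp [hx]

/-- For `y ∈ (ℝ \ {0})^d`, the test function `x ↦ φ (x y)`. -/
noncomputable def dilate {d : ℕ} (y : Fin d → ℝ) (hy : y ∈ Rstar d) (φ : Test d) : Test d where
  toFun x := φ (x * y)
  contDiff' := φ.contDiff.comp (contDiff_id.mul contDiff_const)
  hasCompactSupport' := by
    refine HasCompactSupport.intro (K := (fun z => z * y⁻¹) '' tsupport φ)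
      (φ.hasCompactSupport.isCompact.image (by fun_prop)) fun x hx => ?_
    by_contra h
    refine hx ⟨x * y, subset_tsupport _ h, ?_⟩
    funext j
    simp [hy j]
  tsupport_subset' := by simp

/-- `T ∈ 𝓓_H(ℝ^d)`: for every test function `φ`, the function `y ↦ T_x φ(x y)` on `(ℝ \ {0})^d` is
the restriction of a test function. -/
def MemDH {d : ℕ} (T : Distr d) : Prop :=
  ∀ φ : Test d, ∃ ψ : Test d, ∀ (y : Fin d → ℝ) (hy : y ∈ Rstar d), ψ y = T (dilate y hy φ)

/-- The map `M_T : 𝓓(ℝ^d) → 𝓓(ℝ^d)` for `T ∈ 𝓓_H(ℝ^d)`: `M_T φ` is the continuous extension of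
`y ↦ T_x φ(x y)`, which is unique because `(ℝ \ {0})^d` is dense. -/
noncomputable def MT {d : ℕ} {T : Distr d} (hT : MemDH T) (φ : Test d) : Test d :=
  (hT φ).choose

theorem MT_apply {d : ℕ} {T : Distr d} (hT : MemDH T) (φ : Test d) (y : Fin d → ℝ)
    (hy : y ∈ Rstar d) : MT hT φ y = T (dilate y hy φ) :=
  (hT φ).choose_spec y hy

/-- The functional `L_T(S) = S ⋆ T` on `𝓓(ℝ^d)`, for `T ∈ 𝓓_H(ℝ^d)` and `S ∈ 𝓓'(ℝ^d)`:
`φ ↦ S_y (T_x φ(x y)) = S (M_T φ)`. -/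
noncomputable def LT {d : ℕ} {T : Distr d} (hT : MemDH T) (S : Distr d) : Test d → ℂ :=
  fun φ => S (MT hT φ)

/-- The functional `N_T(S) = S ⋆ T` for `S, T ∈ 𝓔'(ℝ^d)`: `f ↦ S_y (T_x f(x y))`. -/
noncomputable def NT {d : ℕ} (T S : Distr d) (f : (Fin d → ℝ) → ℂ) : ℂ :=
  pairing S fun y => pairing T fun x => f (x * y)

/-- The monomial `x^α` as a distribution: `φ ↦ ∫ x^α φ(x) dx`. -/
noncomputable def monomial {d : ℕ} (α : Fin d → ℕ) : Distr d :=
  (UniformConvergenceCLM.ofFun _ _ _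
    (TestFunction.integralAgainstBilinCLM (ContinuousLinearMap.mul ℂ ℂ) MeasureTheory.volume
      (fun x : Fin d → ℝ => ((∏ j, x j ^ α j : ℝ) : ℂ))))

theorem monomial_apply {d : ℕ} (α : Fin d → ℕ) (φ : Test d) :
    monomial α φ = ∫ x : Fin d → ℝ, ((∏ j, x j ^ α j : ℝ) : ℂ) * φ x := by
  have h : MeasureTheory.LocallyIntegrableOn
      (fun x : Fin d → ℝ => ((∏ j, x j ^ α j : ℝ) : ℂ))
      ((⊤ : TopologicalSpace.Opens (Fin d → ℝ)) : Set (Fin d → ℝ)) MeasureTheory.volume := by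
    have hc : Continuous fun x : Fin d → ℝ => ((∏ j, x j ^ α j : ℝ) : ℂ) := by fun_prop
    exact hc.locallyIntegrable.locallyIntegrableOn _
  refine (TestFunction.integralAgainstBilinCLM_eq_integral h).trans ?_
  simp [mul_comm]

/-- `L ∈ 𝓜(ℝ^d)`: the continuous linear operator `L` on `𝓓'(ℝ^d)` is a Hadamard operator, i.e. it
admits all monomials as eigenvectors. -/
def IsHadamard {d : ℕ} (L : Distr d →L[ℂ] Distr d) : Prop :=
  ∀ α : Fin d → ℕ, ∃ m : ℂ, L (monomial α) = m • monomial α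

/-- The operator `L` on `𝓓'(ℝ^d)` extends `N_T : 𝓔'(ℝ^d) → 𝓔'(ℝ^d)`. -/
def ExtendsNT {d : ℕ} (T : Distr d) (L : Distr d →L[ℂ] Distr d) : Prop :=
  ∀ S ∈ EPrime d, ∀ φ : Test d, L S φ = NT T S φ

/-- The function `σ(x) / x^{α + 𝟏}` on `(ℝ \ {0})^d`, where `σ(x) = ∏_j x_j / |x_j|`. -/
noncomputable def eigenFun {d : ℕ} (α : Fin d → ℕ) (x : Fin d → ℝ) : ℂ :=
  (((∏ j, x j / |x j|) / ∏ j, x j ^ (α j + 1) : ℝ) : ℂ)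

end Hadamard

/-! Everything rests on the function $y\mapsto T_x\varphi(xy)$.

Suppose it vanishes on $\mathbb R_*^d$ for large $y$, with a bound depending on $\varphi$. On the
Baire space $\mathscr D_K$, with $K$ the unit ball, the bound becomes uniform in $\varphi$. If $x_0$
has a zero coordinate, some far-out $y\in\mathbb R_*^d$ carries a neighbourhood of $x_0$ into $K$,
so $T$ vanishes near $x_0$: this is `supp_subset_Rstar`. Under condition 2 the hypothesis holds
because $M_T\varphi$ has compact support. Under condition 1 it holds because $S\mapsto
L(S)(\varphi)$ is continuous for uniform convergence on compact sets, whose members share a bounded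
support (`exists_common_support`), and so kills $\delta_y$ for large $y$. In condition 2,
compactness of the support of $T$ comes from $L_T(\delta_{\mathbf 1})=T$.

Conversely, let $T$ have compact support in $\mathbb R_*^d$. Since $T$ has finite order locally,
$M_T\varphi$ is smooth. It is supported in $\operatorname{supp}\varphi/\operatorname{supp}T$, and
$M_T$ is continuous by a closed graph argument (`exists_clm_eq_pairing`). The transpose of $M_T$ is
the required operator. Interchanging $T$ with $\int y^\alpha\varphi(xy)\,dy$ and substituting gives
the eigenvalues (`transpose_monomial`). Any other extension agrees with it because $\mathscr E'$ is
dense (`dense_EPrime`). -/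

/-! ### Completeness of $\mathscr D_K$ and a closed graph theorem. -/

namespace ContDiffMapSupportedIn

open Filter Function BoundedContinuousFunction

variable {E F E' F' : Type*} [NormedAddCommGroup E] [NormedSpace ℝ E] [NormedAddCommGroup F]
  [NormedSpace ℝ F] [NormedAddCommGroup E'] [NormedSpace ℝ E'] [NormedAddCommGroup F']
  [NormedSpace ℝ F'] {K : TopologicalSpace.Compacts E} {K' : TopologicalSpace.Compacts E'}

/-- The families of bounded functions which are the derivatives of a smooth function supported
in `K` are characterized by pointwise differential relations. -/
theorem mem_range_pi_structureMapCLM_iff (p : Π i : ℕ, E →ᵇ (E [×i]→L[ℝ] F)) :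
    p ∈ Set.range (ContinuousLinearMap.pi (structureMapCLM ℝ ⊤) :
      𝓓_{K}(E, F) →L[ℝ] Π i, E →ᵇ (E [×i]→L[ℝ] F)) ↔
    (∀ x ∉ K, p 0 x = 0) ∧ ∀ (i : ℕ) (x : E), HasFDerivAt (p i) (p (i + 1) x).curryLeft x := by
  constructor
  · rintro ⟨f, rfl⟩
    refine ⟨fun x hx => ?_, fun i x => ?_⟩
    · have h : f x = 0 := f.zero_on_compl hx
      ext v
      simp [h]
    · have h := (f.contDiff.ftaylorSeries).fderiv i (by exact_mod_cast ENat.natCast_lt_top i) x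
      simpa [structureMapCLM_top_apply, ftaylorSeries] using h
  · rintro ⟨h0, h1⟩
    let f : E → F := fun x => (p 0 x).curry0
    have hf : HasFTaylorSeriesUpTo ((⊤ : ℕ∞) : WithTop ℕ∞) f (fun x i => p i x) :=
      ⟨fun x => rfl, fun m _ x => h1 m x, fun m _ => (p m).continuous⟩
    have hs : Set.EqOn f 0 (K : Set E)ᶜ := fun x hx => by
      simp [f, ContinuousMultilinearMap.curry0, h0 x hx]
    refine ⟨⟨f, hf.contDiff, hs⟩, ?_⟩
    ext i x : 2
    have h := hf.eq_iteratedFDeriv (m := i) (by exact_mod_cast le_top) x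
    simp only [ContinuousLinearMap.coe_pi', structureMapCLM_top_apply]
    exact h.symm

/-- The differential relations survive uniform limits of functions together with their derivatives.
With the embedding this makes $\mathscr D_K$ complete and metrizable, hence Baire and barrelled. -/
theorem isClosed_range_pi_structureMapCLM :
    IsClosed (Set.range (ContinuousLinearMap.pi (structureMapCLM ℝ ⊤) :
      𝓓_{K}(E, F) →L[ℝ] Π i, E →ᵇ (E [×i]→L[ℝ] F))) := by
  refine IsSeqClosed.isClosed fun p q hp hpq => ?_
  simp only [mem_range_pi_structureMapCLM_iff] at hp ⊢
  have hu : ∀ i, TendstoUniformly (fun n => ⇑(p n i)) (q i) atTop := fun i =>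
    tendsto_iff_tendstoUniformly.1 (tendsto_pi_nhds.1 hpq i)
  refine ⟨fun x hx => ?_, fun i x => ?_⟩
  · refine tendsto_nhds_unique ((hu 0).tendsto_at x) ?_
    simp [fun n => (hp n).1 x hx]
  · refine hasFDerivAt_of_tendstoUniformly (f := fun n => ⇑(p n i))
      (f' := fun n x => (p n (i + 1) x).curryLeft) (g' := fun x => (q (i + 1) x).curryLeft)
      (l := atTop) ?_ (fun n => (hp n).2 i) ((hu i).tendsto_at) x
    exact (continuousMultilinearCurryLeftEquiv ℝ (fun _ : Fin (i + 1) => E) F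
      ).isometry.uniformContinuous.comp_tendstoUniformly (hu (i + 1))

instance [CompleteSpace F] : CompleteSpace 𝓓_{K}(E, F) :=
  (completeSpace_iff_isComplete_range
    (isUniformEmbedding_pi_structureMapCLM ℝ).toIsUniformInducing).2
    isClosed_range_pi_structureMapCLM.isComplete

instance : (uniformity 𝓓_{K}(E, F)).IsCountablyGenerated :=
  (isUniformEmbedding_pi_structureMapCLM ℝ
    (n := ⊤) (K := K) (E := E) (F := F)).toIsUniformInducing.comap_uniformity ▸ inferInstance

/-- A closed graph theorem: a linear map between spaces of smooth functions with fixed compact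
support is continuous as soon as its composition with all evaluations is. -/
theorem continuous_of_continuous_eval {𝕜 : Type*} [RCLike 𝕜] [NormedSpace 𝕜 F] [NormedSpace 𝕜 F']
    [SMulCommClass ℝ 𝕜 F] [SMulCommClass ℝ 𝕜 F'] [CompleteSpace F]
    (M : 𝓓_{K}(E, F) →ₗ[𝕜] 𝓓_{K'}(E', F')) (hM : ∀ y, Continuous fun φ => M φ y) :
    Continuous M := by
  have key : ∀ (i : ℕ) (y : E') (v : Fin i → E'),
      Continuous fun φ => iteratedFDeriv ℝ i (M φ) y v := by
    intro i
    induction i with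
    | zero => simpa using hM
    | succ i ih =>
      intro y v
      let D : ∀ (i : ℕ) (y : E') (v : Fin i → E'), 𝓓_{K}(E, F) →ₗ[𝕜] F' := fun i y v =>
        { toFun φ := structureMapLM 𝕜 ⊤ i (M φ) y v
          map_add' φ ψ := by simp only [map_add]; rfl
          map_smul' c φ := by simp only [map_smul]; rfl }
      have hD : ∀ i y v φ, D i y v φ = iteratedFDeriv ℝ i (M φ) y v := fun i y v φ => by
        simp [D, structureMapLM_top_apply]
      have hDc : ∀ y v, Continuous (D i y v) := fun y v =>
        (ih y v).congr fun φ => (hD i y v φ).symm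
      -- Difference quotients of the $i$-th derivative in direction `v 0` with step $1/(n+1)$. They
      -- are continuous by induction, and Banach–Steinhaus makes their pointwise limit continuous.
      let g : ℕ → 𝓓_{K}(E, F) →L[𝕜] F' := fun n =>
        ⟨((n : 𝕜) + 1) • (D i (y + (1 / ((n : ℝ) + 1)) • v 0) (Fin.tail v) - D i y (Fin.tail v)),
          ((hDc _ _).sub (hDc _ _)).const_smul ((n : 𝕜) + 1)⟩
      refine (continuousLinearMapOfTendsto (σ₁₂ := RingHom.id 𝕜) (l := atTop) g
        (f := fun φ => iteratedFDeriv ℝ (i + 1) (M φ) y v) ?_).continuous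
      refine tendsto_pi_nhds.2 fun φ => ?_
      have hder : HasFDerivAt (iteratedFDeriv ℝ i (M φ))
          (fderiv ℝ (iteratedFDeriv ℝ i (M φ)) y) y :=
        (((M φ).contDiff.differentiable_iteratedFDeriv
          (by exact_mod_cast ENat.natCast_lt_top i)) y).hasFDerivAt
      have hline := ((ContinuousMultilinearMap.apply ℝ (fun _ : Fin i => E') F'
        (Fin.tail v)).hasFDerivAt.comp y hder).hasLineDerivAt (v 0)
      have hlim : Tendsto (fun n : ℕ => 1 / ((n : ℝ) + 1)) atTop (𝓝[≠] 0) :=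
        tendsto_nhdsWithin_iff.2 ⟨tendsto_one_div_add_atTop_nhds_zero_nat,
          Eventually.of_forall fun n => by
            simp only [Set.mem_compl_iff, Set.mem_singleton_iff]; positivity⟩
      refine (hline.tendsto_slope_zero.comp hlim).congr' (Eventually.of_forall fun n => ?_)
      have hs : ∀ w : F', ((n : 𝕜) + 1) • w = ((n : ℝ) + 1) • w := fun w => by
        rw [add_smul, add_smul, one_smul, one_smul, Nat.cast_smul_eq_nsmul,
          Nat.cast_smul_eq_nsmul]
      simp only [g, Function.comp_apply, ContinuousLinearMap.coe_mk', LinearMap.smul_apply,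
        LinearMap.sub_apply, hD, hs, one_div, inv_inv, ContinuousMultilinearMap.apply_apply]
  refine WithSeminorms.continuous_of_continuous_comp
    (ContDiffMapSupportedIn.withSeminorms 𝕜 E' F' ⊤ K') M fun i => ?_
  -- On a barrelled space lower semicontinuous seminorms are continuous; this one is a supremum of
  -- the continuous functions in `key`.
  refine Seminorm.continuous_of_lowerSemicontinuous _ ?_
  refine lowerSemicontinuous_iff_isClosed_preimage.2 fun c => ?_
  rcases lt_or_ge c 0 with hc | hc
  · convert isClosed_empty
    ext φ
    simpa using hc.trans_le (apply_nonneg _ _)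
  · have : ((ContDiffMapSupportedIn.seminorm 𝕜 E' F' ⊤ K' i).comp M) ⁻¹' Set.Iic c =
        ⋂ (y : E') (v : Fin i → E'), {φ | ‖iteratedFDeriv ℝ i (M φ) y v‖ ≤ c * ∏ j, ‖v j‖} := by
      ext φ
      simp only [Set.mem_preimage, Set.mem_Iic, Seminorm.comp_apply, Set.mem_iInter,
        Set.mem_ofPred_eq]
      refine ⟨fun h y v => ?_, fun h => ?_⟩
      · refine ((iteratedFDeriv ℝ i (M φ) y).le_opNorm v).trans ?_
        gcongr
        exact (norm_iteratedFDeriv_apply_le_seminorm_top 𝕜).trans h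
      · exact (ContDiffMapSupportedIn.seminorm_top_le_iff 𝕜 hc i (M φ)).2 fun x _ =>
          ContinuousMultilinearMap.opNorm_le_bound hc (h x)
    rw [this]
    exact isClosed_iInter fun y => isClosed_iInter fun v =>
      isClosed_le (key i y v).norm continuous_const

end ContDiffMapSupportedIn

/-! ### Smooth functions of two variables as smooth curves in $C(K,V)$. -/

namespace ContinuousMap

open Filter

variable {E₁ E₂ V : Type*} [NormedAddCommGroup E₁] [NormedSpace ℝ E₁]
  [NormedAddCommGroup E₂] [NormedSpace ℝ E₂] [NormedAddCommGroup V] [NormedSpace ℝ V]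
  {K : Set E₂}

theorem continuous_of_apply_eq {X Y Z : Type*} [TopologicalSpace X] [TopologicalSpace Y]
    [TopologicalSpace Z] {K : Set Y} {F : X × Y → Z} (hF : Continuous F) {c : X → C(K, Z)}
    (hc : ∀ y (x : K), c y x = F (y, x)) : Continuous c := by
  have : c = (⟨fun p : X × K => F (p.1, p.2), by fun_prop⟩ : C(X × K, Z)).curry := by
    ext y x
    exact hc y x
  rw [this]
  exact ContinuousMap.continuous _

variable [CompactSpace K]

/-- Compactness of $K$ makes the derivative of $F$ at $(z,x)$ close to that at $(y,x)$ uniformly in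
$x$; the mean value inequality then bounds the remainder in the sup norm. -/
theorem hasFDerivAt_of_apply_eq [FiniteDimensional ℝ E₁] {F : E₁ × E₂ → V} (hF : ContDiff ℝ 1 F)
    {c : E₁ → C(K, V)} (hc : ∀ y (x : K), c y x = F (y, x)) (y : E₁) :
    ∃ A : E₁ →L[ℝ] C(K, V), (∀ v (x : K), A v x = fderiv ℝ F (y, x) (v, 0)) ∧
      HasFDerivAt c A y := by
  have hF' : Continuous (fderiv ℝ F) := hF.continuous_fderiv one_ne_zero
  let A : E₁ →ₗ[ℝ] C(K, V) :=
    { toFun v := ⟨fun x => fderiv ℝ F (y, x) (v, 0), by fun_prop⟩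
      map_add' v w := by
        ext x
        have : (v + w, (0 : E₂)) = (v, 0) + (w, 0) := by simp
        simp only [coe_mk, add_apply]
        rw [this, map_add]
      map_smul' r v := by
        ext x
        have : (r • v, (0 : E₂)) = r • (v, 0) := by simp
        simp only [coe_mk, smul_apply, RingHom.id_apply]
        rw [this, map_smul] }
  refine ⟨LinearMap.toContinuousLinearMap A, fun v x => rfl, ?_⟩
  rw [hasFDerivAt_iff_isLittleO_nhds_zero, Asymptotics.isLittleO_iff]
  intro ε hε
  let D : E₁ → C(K, E₁ × E₂ →L[ℝ] V) := fun z => ⟨fun x => fderiv ℝ F (z, x), by fun_prop⟩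
  have hD : Continuous D := continuous_of_apply_eq hF' fun _ _ => rfl
  obtain ⟨δ, hδ, hball⟩ := (Metric.continuous_iff (f := D)).1 hD y ε hε
  filter_upwards [Metric.ball_mem_nhds (0 : E₁) hδ] with h hh
  refine (norm_le _ (by positivity)).2 fun x => ?_
  have hder : ∀ z ∈ Metric.ball y δ, HasFDerivWithinAt (fun z => F (z, (x : E₂)))
      ((fderiv ℝ F (z, x)).comp (ContinuousLinearMap.inl ℝ E₁ E₂)) (Metric.ball y δ) z := by
    intro z _
    have h1 : HasFDerivAt F (fderiv ℝ F (z, x)) (z, (x : E₂)) :=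
      ((hF.differentiable one_ne_zero) _).hasFDerivAt
    exact (h1.comp z (hasFDerivAt_prodMk_left z (x : E₂))).hasFDerivWithinAt
  have hbound : ∀ z ∈ Metric.ball y δ,
      ‖(fderiv ℝ F (z, x)).comp (ContinuousLinearMap.inl ℝ E₁ E₂) -
        (fderiv ℝ F (y, x)).comp (ContinuousLinearMap.inl ℝ E₁ E₂)‖ ≤ ε := by
    intro z hz
    rw [← ContinuousLinearMap.sub_comp]
    refine (ContinuousLinearMap.opNorm_comp_le _ _).trans ?_
    have h1 : ‖(D z - D y) x‖ ≤ ε :=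
      ((D z - D y).norm_coe_le_norm x).trans (by rw [← dist_eq_norm]; exact (hball z hz).le)
    have h2 := ContinuousLinearMap.norm_inl_le_one ℝ E₁ E₂
    calc _ ≤ ε * 1 := by
          gcongr
          exact h1
      _ = ε := mul_one ε
  have := (convex_ball y δ).norm_image_sub_le_of_norm_hasFDerivWithin_le' hder hbound
    (Metric.mem_ball_self hδ) (y := y + h) (by simpa using hh)
  simpa [hc, A] using this

theorem contDiff_of_apply_eq [FiniteDimensional ℝ E₁] {F : E₁ × E₂ → V}
    (hF : ContDiff ℝ ((⊤ : ℕ∞) : WithTop ℕ∞) F)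
    {c : E₁ → C(K, V)} (hc : ∀ y (x : K), c y x = F (y, x)) :
    ContDiff ℝ ((⊤ : ℕ∞) : WithTop ℕ∞) c := by
  refine contDiff_infty.2 fun n => ?_
  induction n generalizing F c with
  | zero => exact contDiff_zero.2 (continuous_of_apply_eq hF.continuous hc)
  | succ n ih =>
    have h1 : ContDiff ℝ 1 F := hF.of_le (by exact_mod_cast le_top)
    choose A hA hcA using hasFDerivAt_of_apply_eq h1 hc
    push_cast
    refine contDiff_succ_iff_fderiv_apply.2 ⟨fun y => (hcA y).differentiableAt, by simp,
      fun v => ?_⟩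
    have hFv : ContDiff ℝ ((⊤ : ℕ∞) : WithTop ℕ∞) fun p => fderiv ℝ F p (v, 0) :=
      (hF.fderiv_right (by simp)).clm_apply contDiff_const
    exact ih hFv fun y x => by rw [(hcA y).fderiv, hA]

theorem iteratedFDeriv_of_apply_eq [FiniteDimensional ℝ E₁] {F : E₁ × E₂ → V}
    (hF : ContDiff ℝ ((⊤ : ℕ∞) : WithTop ℕ∞) F)
    {c : E₁ → C(K, V)} (hc : ∀ y (x : K), c y x = F (y, x)) (i : ℕ) (y : E₁) (v : Fin i → E₁)
    (x : K) : iteratedFDeriv ℝ i c y v x = iteratedFDeriv ℝ i (fun z => F (z, x)) y v := by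
  have h := (ContinuousMap.evalCLM ℝ x).iteratedFDeriv_comp_left
    ((contDiff_of_apply_eq hF hc).contDiffAt (x := y)) (i := i) (by exact_mod_cast le_top)
  have h2 : (ContinuousMap.evalCLM ℝ x : C(K, V) →L[ℝ] V) ∘ c = fun z => F (z, x) := by
    ext z
    exact hc z x
  rw [h2] at h
  rw [h]
  rfl

theorem contDiff_clm_of_apply_eq [NormedSpace ℂ V] [IsScalarTower ℝ ℂ V] [FiniteDimensional ℝ E₁]
    {F : E₁ × E₂ → V} (hF : ContDiff ℝ ((⊤ : ℕ∞) : WithTop ℕ∞) F)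
    {c : E₁ → C(K, V)} (hc : ∀ y (x : K), c y x = F (y, x)) (l : C(K, V) →L[ℂ] ℂ) :
    ContDiff ℝ ((⊤ : ℕ∞) : WithTop ℕ∞) fun y => l (c y) :=
  (l.restrictScalars ℝ).contDiff.comp (contDiff_of_apply_eq hF hc)

theorem exists_clm_eq_integral [NormedSpace ℂ V] [CompleteSpace V] {X Y : Type*}
    [TopologicalSpace X] [TopologicalSpace Y] {K : Set Y} [CompactSpace K] [T2Space X]
    [SecondCountableTopology X] [MeasurableSpace X] [BorelSpace X] {F : X × Y → V}
    (hF : Continuous F) {c : X → C(K, V)} (hc : ∀ y (x : K), c y x = F (y, x)) (l : C(K, V) →L[ℂ] ℂ)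
    {Q : Set X} (hQ : IsCompact Q) (μ : MeasureTheory.Measure X)
    [MeasureTheory.IsFiniteMeasureOnCompacts μ] :
    MeasureTheory.IntegrableOn (fun y => l (c y)) Q μ ∧
    ∃ r : C(K, V), (∀ x : K, r x = ∫ y in Q, F (y, x) ∂μ) ∧ l r = ∫ y in Q, l (c y) ∂μ := by
  have hint : MeasureTheory.IntegrableOn c Q μ :=
    (continuous_of_apply_eq hF hc).continuousOn.integrableOn_compact hQ
  refine ⟨l.integrable_comp hint, ∫ y in Q, c y ∂μ, fun x => ?_, (l.integral_comp_comm hint).symm⟩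
  rw [integral_apply hint]
  simp only [hc]

theorem exists_integral_clm (V : Type*) [NormedAddCommGroup V] [NormedSpace ℝ V] {X : Type*}
    [TopologicalSpace X] [CompactSpace X] [MeasurableSpace X] [OpensMeasurableSpace X]
    (μ : MeasureTheory.Measure X) [MeasureTheory.IsFiniteMeasure μ] [SecondCountableTopology X] :
    ∃ I : C(X, V) →L[ℝ] V, ∀ w : C(X, V), I w = ∫ x, w x ∂μ := by
  have hint : ∀ w : C(X, V), MeasureTheory.Integrable w μ := fun w =>
    w.continuous.integrable_of_hasCompactSupport (HasCompactSupport.of_compactSpace _)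
  refine ⟨LinearMap.mkContinuous ⟨⟨fun w => ∫ x, w x ∂μ, fun w u =>
    MeasureTheory.integral_add (hint w) (hint u)⟩, fun c w => MeasureTheory.integral_smul c w⟩
    (μ.real Set.univ) fun w => ?_, fun w => rfl⟩
  rw [mul_comm]
  exact MeasureTheory.norm_integral_le_of_norm_le_const
    (Filter.Eventually.of_forall fun x => w.norm_coe_le_norm x)

end ContinuousMap

/-- The bound makes $T$ vanish on $\ker J$, so it descends to a bounded functional on the range of
$J$, which Hahn–Banach extends. -/
theorem LinearMap.exists_comp_eq_of_norm_le {𝕜 V W : Type*} [RCLike 𝕜] [AddCommGroup V] [Module 𝕜 V]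
    [NormedAddCommGroup W] [NormedSpace 𝕜 W] (J : V →ₗ[𝕜] W) (T : V →ₗ[𝕜] 𝕜) (C : ℝ)
    (h : ∀ v, ‖T v‖ ≤ C * ‖J v‖) : ∃ l : W →L[𝕜] 𝕜, ∀ v, T v = l (J v) := by
  obtain ⟨g, hg⟩ := J.rangeRestrict.exists_rightInverse_of_surjective J.range_rangeRestrict
  have hg' : ∀ w : J.range, J (g w) = w := fun w =>
    congrArg Subtype.val (LinearMap.congr_fun hg w)
  obtain ⟨l, hl, -⟩ := exists_extension_norm_eq J.range
    ((T.comp g).mkContinuous C fun w => by simpa [hg'] using h (g w))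
  refine ⟨l, fun v => ?_⟩
  have h1 := hl (J.rangeRestrict v)
  have h2 := h (v - g (J.rangeRestrict v))
  rw [map_sub, map_sub, hg'] at h2
  have h3 : ((J.rangeRestrict v : J.range) : W) = J v := rfl
  simp only [h3, sub_self, norm_zero, mul_zero,
    norm_le_zero_iff, sub_eq_zero] at h2
  simpa [h2] using h1.symm

/-! ### Finite order; differentiation and integration under a distribution. -/

namespace ContDiffMapSupportedIn

open MeasureTheory

variable {E E₁ : Type*} [NormedAddCommGroup E] [NormedSpace ℝ E] [NormedAddCommGroup E₁]
  [NormedSpace ℝ E₁] {K : TopologicalSpace.Compacts E}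

/-- A continuous linear functional on `𝓓_K` is of finite order. -/
theorem exists_finite_order (T : 𝓓_{K}(E, ℂ) →L[ℂ] ℂ) :
    ∃ (s : Finset ℕ) (l : Π i : s, C(K, E [×i]→L[ℝ] ℂ) →L[ℂ] ℂ),
      ∀ (ψ : 𝓓_{K}(E, ℂ)) (r : Π i : s, C(K, E [×i]→L[ℝ] ℂ)),
        (∀ (i : s) (x : K), r i x = iteratedFDeriv ℝ i ψ x) → T ψ = ∑ i, l i (r i) := by
  classical
  obtain ⟨s, C, -, hC⟩ := Seminorm.bound_of_continuous
    (ContDiffMapSupportedIn.withSeminorms ℂ E ℂ ⊤ K) ((normSeminorm ℂ ℂ).comp T.toLinearMap)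
    (continuous_norm.comp T.continuous)
  -- The finitely many derivatives whose sup norms on $K$ control $T$.
  let J : 𝓓_{K}(E, ℂ) →ₗ[ℂ] Π i : s, C(K, E [×i]→L[ℝ] ℂ) := LinearMap.pi fun i =>
    { toFun ψ := (structureMapLM ℂ ⊤ (i : ℕ) ψ).toContinuousMap.restrict K
      map_add' ψ χ := by rw [map_add]; rfl
      map_smul' c ψ := by rw [map_smul]; rfl }
  have hJ : ∀ ψ i (x : K), J ψ i x = iteratedFDeriv ℝ i ψ x := fun ψ i x =>
    congrFun (structureMapLM_top_apply ℂ ψ) x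
  have hTJ : ∀ ψ, ‖T.toLinearMap ψ‖ ≤ C * ‖J ψ‖ := fun ψ => by
    refine (hC ψ).trans ?_
    have hn : 0 ≤ ‖J ψ‖ := norm_nonneg _
    rw [smul_apply, NNReal.smul_def, smul_eq_mul]
    gcongr
    refine Seminorm.finset_sup_apply_le hn fun i hi => ?_
    refine (ContDiffMapSupportedIn.seminorm_top_le_iff ℂ hn i ψ).2 fun x hx => ?_
    have := (J ψ ⟨i, hi⟩).norm_coe_le_norm ⟨x, hx⟩
    rw [hJ] at this
    exact this.trans (norm_le_pi_norm (J ψ) ⟨i, hi⟩)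
  obtain ⟨l, hl⟩ := LinearMap.exists_comp_eq_of_norm_le (𝕜 := ℂ)
    (W := Π i : s, C(K, E [×i]→L[ℝ] ℂ)) J T.toLinearMap C hTJ
  refine ⟨s, fun i => l.comp (ContinuousLinearMap.single ℂ
    (fun i : s => C(K, E [×i]→L[ℝ] ℂ)) i), fun ψ r hr => ?_⟩
  have : J ψ = r := by
    ext i x : 2
    rw [hJ, hr]
  rw [← T.coe_coe, hl, this]
  conv_lhs => rw [← LinearMap.sum_single_apply _ r, map_sum]
  rfl

/-- Expressing the derivatives in $x$ through the full derivative shows that they are jointly smooth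
in $(y,x)$. -/
theorem iteratedFDeriv_slice {Ψ : E₁ × E → ℂ} (hΨ : ContDiff ℝ ((⊤ : ℕ∞) : WithTop ℕ∞) Ψ)
    (i : ℕ) (y : E₁) (x : E) : iteratedFDeriv ℝ i (fun x => Ψ (y, x)) x =
      (iteratedFDeriv ℝ i Ψ (y, x)).compContinuousLinearMap
        fun _ => ContinuousLinearMap.inr ℝ E₁ E := by
  have h := (ContinuousLinearMap.inr ℝ E₁ E).iteratedFDeriv_comp_right
    (f := fun p => Ψ (p + (y, 0))) (hΨ.comp (contDiff_id.add contDiff_const)) x (i := i)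
    (by exact_mod_cast le_top)
  rw [iteratedFDeriv_comp_add_right] at h
  simpa [Function.comp_def] using h

theorem contDiff_partial_iteratedFDeriv {Ψ : E₁ × E → ℂ}
    (hΨ : ContDiff ℝ ((⊤ : ℕ∞) : WithTop ℕ∞) Ψ) (i : ℕ) :
    ContDiff ℝ ((⊤ : ℕ∞) : WithTop ℕ∞) fun p => (iteratedFDeriv ℝ i Ψ p).compContinuousLinearMap
      fun _ => ContinuousLinearMap.inr ℝ E₁ E :=
  (ContinuousMultilinearMap.compContinuousLinearMapL (𝕜 := ℝ)
    (F := ℂ) fun _ : Fin i => ContinuousLinearMap.inr ℝ E₁ E).contDiff.comp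
    (hΨ.iteratedFDeriv_right (i := i) (by exact_mod_cast le_top))

/-- Applying a distribution to a smooth family of test functions gives a smooth function. -/
theorem contDiff_apply_family [FiniteDimensional ℝ E₁] (T : 𝓓_{K}(E, ℂ) →L[ℂ] ℂ) {Ψ : E₁ × E → ℂ}
    (hΨ : ContDiff ℝ ((⊤ : ℕ∞) : WithTop ℕ∞) Ψ) {S : E₁ → 𝓓_{K}(E, ℂ)}
    (hS : ∀ y x, S y x = Ψ (y, x)) :
    ContDiff ℝ ((⊤ : ℕ∞) : WithTop ℕ∞) fun y => T (S y) := by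
  obtain ⟨s, l, hl⟩ := exists_finite_order T
  have hS' : ∀ y, ⇑(S y) = fun x => Ψ (y, x) := fun y => funext (hS y)
  let c : E₁ → Π i : s, C(K, E [×i]→L[ℝ] ℂ) := fun y i => ⟨fun x =>
    (iteratedFDeriv ℝ i Ψ (y, x)).compContinuousLinearMap fun _ => ContinuousLinearMap.inr ℝ E₁ E,
    (contDiff_partial_iteratedFDeriv hΨ i).continuous.comp (by fun_prop)⟩
  have hT : (fun y => T (S y)) = fun y => ∑ i, l i (c y i) := funext fun y =>
    hl _ _ fun i x => by rw [hS', iteratedFDeriv_slice hΨ]; rfl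
  rw [hT]
  exact ContDiff.sum fun i _ => ContinuousMap.contDiff_clm_of_apply_eq
    (contDiff_partial_iteratedFDeriv hΨ i) (fun _ _ => rfl) (l i)

/-- A distribution commutes with the integration of a smooth family of test functions. -/
theorem integral_apply_family [FiniteDimensional ℝ E] [FiniteDimensional ℝ E₁]
    [MeasurableSpace E₁] [BorelSpace E₁] (μ : Measure E₁) [IsFiniteMeasureOnCompacts μ]
    (T : 𝓓_{K}(E, ℂ) →L[ℂ] ℂ) {Ψ : E₁ × E → ℂ}
    (hΨ : ContDiff ℝ ((⊤ : ℕ∞) : WithTop ℕ∞) Ψ) {S : E₁ → 𝓓_{K}(E, ℂ)}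
    (hS : ∀ y x, S y x = Ψ (y, x)) {Q : Set E₁} (hQ : IsCompact Q) {I : 𝓓_{K}(E, ℂ)}
    (hI : ∀ x, I x = ∫ y in Q, Ψ (y, x) ∂μ) :
    T I = ∫ y in Q, T (S y) ∂μ := by
  obtain ⟨s, l, hl⟩ := exists_finite_order T
  have hS' : ∀ y, ⇑(S y) = fun x => Ψ (y, x) := fun y => funext (hS y)
  let c : E₁ → Π i : s, C(K, E [×i]→L[ℝ] ℂ) := fun y i => ⟨fun x =>
    (iteratedFDeriv ℝ i Ψ (y, x)).compContinuousLinearMap fun _ => ContinuousLinearMap.inr ℝ E₁ E,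
    (contDiff_partial_iteratedFDeriv hΨ i).continuous.comp (by fun_prop)⟩
  have hF : ∀ i, Continuous fun p => (iteratedFDeriv ℝ i Ψ p).compContinuousLinearMap
      fun _ => ContinuousLinearMap.inr ℝ E₁ E := fun i =>
    (contDiff_partial_iteratedFDeriv hΨ i).continuous
  have hT : ∀ y, T (S y) = ∑ i, l i (c y i) := fun y =>
    hl _ _ fun i x => by rw [hS', iteratedFDeriv_slice hΨ]; rfl
  simp only [hT]
  choose hint r hr hlr using fun i : s => ContinuousMap.exists_clm_eq_integral (hF i)
    (c := fun y => c y i) (fun _ _ => rfl) (l i) hQ μ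
  rw [integral_finsetSum _ fun i _ => hint i]
  simp only [← hlr]
  refine hl _ _ fun i x => ?_
  rw [hr]
  have : CompactSpace Q := isCompact_iff_compactSpace.1 hQ
  have : IsFiniteMeasure (μ.comap ((↑) : Q → E₁)) := ⟨by
    rw [Measure.comap_apply _ Subtype.val_injective
      (fun t ht => hQ.measurableSet.subtype_image ht) _ MeasurableSet.univ]
    simpa using hQ.measure_lt_top⟩
  obtain ⟨L, hL⟩ := ContinuousMap.exists_integral_clm ℂ (μ.comap ((↑) : Q → E₁))
  -- The variables change roles: $I$ is the integration functional on $C(Q)$ applied to the smooth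
  -- curve $x\mapsto\Psi(\cdot,x)$, so it can be differentiated under the integral.
  let b : E → C(Q, ℂ) := fun x => ⟨fun y => Ψ (y, x), hΨ.continuous.comp (by fun_prop)⟩
  have hΨ' : ContDiff ℝ ((⊤ : ℕ∞) : WithTop ℕ∞) fun p : E × E₁ => Ψ (p.2, p.1) :=
    hΨ.comp (contDiff_snd.prodMk contDiff_fst)
  have hI' : ⇑I = L ∘ b := by
    ext x
    rw [hI, Function.comp_apply, hL, ← integral_subtype_comap hQ.measurableSet]
    rfl
  rw [hI', L.iteratedFDeriv_comp_left
    (ContinuousMap.contDiff_of_apply_eq hΨ' fun _ _ => rfl).contDiffAt (by exact_mod_cast le_top)]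
  ext v
  have hcx : IntegrableOn (fun y => (iteratedFDeriv ℝ i Ψ (y, x)).compContinuousLinearMap
      fun _ => ContinuousLinearMap.inr ℝ E₁ E) Q μ :=
    ((hF i).comp (by fun_prop : Continuous fun y : E₁ => (y, (x : E)))).continuousOn
      |>.integrableOn_compact hQ
  rw [ContinuousMultilinearMap.integral_apply hcx,
    ContinuousLinearMap.compContinuousMultilinearMap_coe, Function.comp_apply, hL,
    ← integral_subtype_comap hQ.measurableSet]
  refine integral_congr_ae (Filter.Eventually.of_forall fun y => ?_)
  have h2 := ContinuousMap.iteratedFDeriv_of_apply_eq hΨ' (c := b) (fun _ _ => rfl) i x v y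
  simp only [h2, iteratedFDeriv_slice hΨ]

end ContDiffMapSupportedIn

/-- The closed subspaces killed by all `l y` with $\|y\|>n$ exhaust $V$; by Baire one has interior
points and is therefore everything. -/
theorem exists_forall_lt_norm_eq_zero {𝕜 V X : Type*} [NontriviallyNormedField 𝕜] [AddCommGroup V]
    [Module 𝕜 V] [TopologicalSpace V] [ContinuousAdd V] [ContinuousSMul 𝕜 V] [BaireSpace V]
    [Norm X] (s : Set X) (l : X → V → 𝕜) (hl : ∀ y ∈ s, ∃ A : V →L[𝕜] 𝕜, l y = A)
    (h : ∀ v, ∃ R : ℝ, ∀ y ∈ s, R < ‖y‖ → l y v = 0) :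
    ∃ R : ℝ, ∀ y ∈ s, R < ‖y‖ → ∀ v, l y v = 0 := by
  choose! A hA using hl
  let W : ℕ → Submodule 𝕜 V := fun n => ⨅ y ∈ {y ∈ s | (n : ℝ) < ‖y‖}, (A y).ker
  have hmem : ∀ n v, v ∈ W n ↔ ∀ y ∈ s, (n : ℝ) < ‖y‖ → l y v = 0 := fun n v => by
    simp only [W, Submodule.mem_iInf, LinearMap.mem_ker]
    exact ⟨fun h y hy hn => by rw [hA y hy]; exact h y ⟨hy, hn⟩,
      fun h y hy => by have := h y hy.1 hy.2; rwa [hA y hy.1] at this⟩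
  have hcl : ∀ n, IsClosed (W n : Set V) := fun n => by
    simp only [W, Submodule.coe_iInf]
    exact isClosed_biInter fun y _ => (A y).isClosed_ker
  have hcov : ⋃ n, (W n : Set V) = Set.univ := by
    refine Set.eq_univ_of_forall fun v => ?_
    obtain ⟨R, hR⟩ := h v
    obtain ⟨n, hn⟩ := exists_nat_ge R
    exact Set.mem_iUnion.2 ⟨n, (hmem n v).2 fun y hy hny => hR y hy (hn.trans_lt hny)⟩
  obtain ⟨n, hn⟩ := nonempty_interior_of_iUnion_of_closed hcl hcov
  refine ⟨n, fun y hy hny v => ?_⟩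
  have : W n = ⊤ := Submodule.eq_top_of_nonempty_interior' _ hn
  exact (hmem n v).1 (this ▸ Submodule.mem_top) y hy hny

/-! ### The space of test functions: continuity and compact sets. -/

namespace Hadamard

open Filter

variable {d : ℕ}

theorem subset_top (K : Set (Fin d → ℝ)) :
    K ⊆ ((⊤ : TopologicalSpace.Opens (Fin d → ℝ)) : Set (Fin d → ℝ)) := Set.subset_univ _

/-- A test function as an element of `𝓓_K`, where `K` contains its support. -/
noncomputable def toSupportedIn (K : TopologicalSpace.Compacts (Fin d → ℝ)) (φ : Test d)
    (h : ∀ x ∉ K, φ x = 0) : 𝓓_{K}((Fin d → ℝ), ℂ) := ⟨φ, φ.contDiff, fun x hx => h x hx⟩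

theorem ofSupportedIn_toSupportedIn (K : TopologicalSpace.Compacts (Fin d → ℝ)) (φ : Test d)
    (h : ∀ x ∉ K, φ x = 0) :
    TestFunction.ofSupportedIn (subset_top (K : Set (Fin d → ℝ))) (toSupportedIn K φ h) = φ := rfl

theorem continuous_eval (x : Fin d → ℝ) : Continuous fun φ : Test d => φ x :=
  (BoundedContinuousFunction.evalCLM ℝ x).continuous.comp
    (TestFunction.toBoundedContinuousFunctionCLM ℝ).continuous

/-- A closed graph theorem on the space of test functions. -/
theorem continuous_of_continuous_eval (M : Test d →ₗ[ℂ] Test d)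
    (hM : ∀ y, Continuous fun φ => M φ y)
    (hsupp : ∀ K : TopologicalSpace.Compacts (Fin d → ℝ),
      ∃ K' : TopologicalSpace.Compacts (Fin d → ℝ),
        ∀ φ : Test d, (∀ x ∉ K, φ x = 0) → ∀ x ∉ K', M φ x = 0) : Continuous M := by
  refine (TestFunction.continuous_iff_continuous_comp M).2 fun K hK => ?_
  obtain ⟨K', hK'⟩ := hsupp K
  let M' : 𝓓_{K}((Fin d → ℝ), ℂ) →ₗ[ℂ] 𝓓_{K'}((Fin d → ℝ), ℂ) :=
    { toFun φ := toSupportedIn K' (M (TestFunction.ofSupportedIn hK φ))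
        (hK' _ fun x hx => φ.zero_on_compl hx)
      map_add' φ ψ := by
        ext x
        exact congrArg (fun u : Test d => u x) (M.map_add (TestFunction.ofSupportedIn hK φ)
          (TestFunction.ofSupportedIn hK ψ))
      map_smul' c φ := by
        ext x
        exact congrArg (fun u : Test d => u x) (M.map_smul c (TestFunction.ofSupportedIn hK φ)) }
  have hM' : Continuous M' := ContDiffMapSupportedIn.continuous_of_continuous_eval M' fun y =>
    (hM y).comp (TestFunction.continuous_ofSupportedIn hK)
  exact (TestFunction.continuous_ofSupportedIn (subset_top (K' : Set (Fin d → ℝ)))).comp hM'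

/-- The elements of a compact set of test functions are supported in a common ball. -/
theorem exists_common_support {C : Set (Test d)} (hC : IsCompact C) :
    ∃ R : ℝ, ∀ φ ∈ C, ∀ x, R < ‖x‖ → φ x = 0 := by
  by_contra! hcon
  choose φ hφC x hx hφx using fun n : ℕ => hcon n
  have hzero : ∀ (K : Set (Fin d → ℝ)), IsCompact K → ∃ N : ℕ, ∀ n ≥ N, x n ∉ K := by
    intro K hK
    obtain ⟨R, hR⟩ := hK.isBounded.exists_norm_le
    obtain ⟨N, hN⟩ := exists_nat_ge R
    refine ⟨N, fun n hn hxn => ?_⟩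
    have h1 := hR _ hxn
    have h2 := hx n
    have h3 : (N : ℝ) ≤ n := by exact_mod_cast hn
    linarith
  -- Only finitely many of the points `x n` lie in $K$, so the weighted evaluations at them are
  -- bounded on $\mathscr D_K$ by the sup norm alone. The weights are chosen to give the value $n$
  -- on `φ n`, so the operator `A` below sends $C$ to an unbounded set.
  have hbd : ∀ K : TopologicalSpace.Compacts (Fin d → ℝ), ∃ B : ℝ, 0 ≤ B ∧
      ∀ ψ : Test d, (∀ x ∉ K, ψ x = 0) → ∀ b : ℝ, (∀ x, ‖ψ x‖ ≤ b) →
        ∀ n : ℕ, ‖(n : ℂ) * (φ n (x n))⁻¹ * ψ (x n)‖ ≤ B * b := by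
    intro K
    obtain ⟨N, hN⟩ := hzero K K.isCompact
    refine ⟨∑ n ∈ Finset.range N, ‖(n : ℂ) * (φ n (x n))⁻¹‖,
      Finset.sum_nonneg fun _ _ => norm_nonneg _, fun ψ hψ b hb n => ?_⟩
    have hb0 : 0 ≤ b := (norm_nonneg _).trans (hb 0)
    have hB0 : 0 ≤ ∑ n ∈ Finset.range N, ‖(n : ℂ) * (φ n (x n))⁻¹‖ :=
      Finset.sum_nonneg fun _ _ => norm_nonneg _
    by_cases hn : n < N
    · rw [norm_mul]
      exact mul_le_mul (Finset.single_le_sum (f := fun n : ℕ => ‖(n : ℂ) * (φ n (x n))⁻¹‖)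
        (fun _ _ => norm_nonneg _) (Finset.mem_range.2 hn)) (hb _) (norm_nonneg _) hB0
    · rw [hψ _ (hN n (not_lt.1 hn)), mul_zero, norm_zero]
      positivity
  have hbdd : ∀ ψ : Test d, ∃ B : ℝ, ∀ n : ℕ, ‖(n : ℂ) * (φ n (x n))⁻¹ * ψ (x n)‖ ≤ B := by
    intro ψ
    obtain ⟨b, hb⟩ := ψ.continuous.bounded_above_of_compact_support ψ.hasCompactSupport
    obtain ⟨B, -, hB⟩ := hbd ⟨tsupport ψ, ψ.hasCompactSupport⟩
    exact ⟨B * b, hB ψ (fun x hx => image_eq_zero_of_notMem_tsupport hx) b hb⟩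
  let a : Test d → BoundedContinuousFunction ℕ ℂ := fun ψ =>
    BoundedContinuousFunction.ofNormedAddCommGroupDiscrete
      (fun n : ℕ => (n : ℂ) * (φ n (x n))⁻¹ * ψ (x n)) (hbdd ψ).choose (hbdd ψ).choose_spec
  have ha : ∀ ψ (n : ℕ), a ψ n = (n : ℂ) * (φ n (x n))⁻¹ * ψ (x n) := fun _ _ => rfl
  let A : Test d →ₗ[ℂ] BoundedContinuousFunction ℕ ℂ :=
    { toFun := a
      map_add' ψ χ := by
        ext n
        exact mul_add _ _ _
      map_smul' c ψ := by
        ext n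
        exact mul_left_comm _ c _ }
  have hA : Continuous A := by
    refine (TestFunction.continuous_iff_continuous_comp A).2 fun K hK => ?_
    obtain ⟨B, hB0, hB⟩ := hbd K
    refine WithSeminorms.continuous_normedSpace_rng (BoundedContinuousFunction ℕ ℂ)
      (ContDiffMapSupportedIn.withSeminorms ℂ (Fin d → ℝ) ℂ ⊤ K)
      (A.comp (TestFunction.ofSupportedInCLM ℂ hK).toLinearMap) ⟨{0}, ⟨B, hB0⟩, fun ψ => ?_⟩
    have hb : ∀ z, ‖ψ z‖ ≤ ContDiffMapSupportedIn.seminorm ℂ (Fin d → ℝ) ℂ ⊤ K 0 ψ := fun z =>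
      ContDiffMapSupportedIn.norm_apply_le_seminorm ℂ
    have h0 : 0 ≤ B * ContDiffMapSupportedIn.seminorm ℂ (Fin d → ℝ) ℂ ⊤ K 0 ψ :=
      mul_nonneg hB0 (apply_nonneg _ _)
    rw [Finset.sup_singleton]
    exact (BoundedContinuousFunction.norm_le h0).2
      (hB (TestFunction.ofSupportedIn hK ψ) (fun z hz => ψ.zero_on_compl hz) _ hb)
  obtain ⟨c, hc⟩ := (hC.image hA).isBounded.exists_norm_le
  obtain ⟨n, hn⟩ := exists_nat_gt c
  have h1 := hc _ ⟨φ n, hφC n, rfl⟩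
  have h2 := (A (φ n)).norm_coe_le_norm n
  have h3 : A (φ n) n = n := by
    change (n : ℂ) * (φ n (x n))⁻¹ * φ n (x n) = n
    rw [mul_assoc, inv_mul_cancel₀ (hφx n), mul_one]
  rw [h3, Complex.norm_natCast] at h2
  linarith

end Hadamard

/-! ### Dilations, Dirac distributions and the support of $T$. -/

namespace Hadamard

open Filter

variable {d : ℕ}

theorem one_mem_Rstar : (1 : Fin d → ℝ) ∈ Rstar d := fun _ => one_ne_zero

theorem isOpen_Rstar : IsOpen (Rstar d) := by
  simp only [Rstar, Set.ofPred_forall]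
  exact isOpen_iInter_of_finite fun j => isOpen_ne_fun (by fun_prop) continuous_const

theorem dense_Rstar : Dense (Rstar d) := by
  have : Rstar d = Set.univ.pi fun _ => {0}ᶜ := by ext x; simp [Rstar]
  rw [this]
  exact dense_pi _ fun _ _ => dense_compl_singleton 0

/-- Dilation by an element of `(ℝ \ {0})^d` as an operator on test functions. -/
noncomputable def dilateCLM (y : Fin d → ℝ) (hy : y ∈ Rstar d) : Test d →L[ℂ] Test d where
  toFun := dilate y hy
  map_add' _ _ := rfl
  map_smul' _ _ := rfl
  cont := by
    refine continuous_of_continuous_eval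
      ⟨⟨dilate y hy, fun _ _ => rfl⟩, fun _ _ => rfl⟩ (fun x => continuous_eval (x * y))
      fun K => ⟨⟨(fun z => z * y⁻¹) '' K, K.isCompact.image (by fun_prop)⟩, fun φ hφ x hx => ?_⟩
    refine hφ _ fun hxK => hx ⟨x * y, hxK, ?_⟩
    funext j
    simp [hy j]

/-- The operator `φ ↦ χ · (φ ∘ g)` on test functions. -/
noncomputable def mulComp (χ : Test d) {g : (Fin d → ℝ) → Fin d → ℝ}
    (hg : ContDiff ℝ ((⊤ : ℕ∞) : WithTop ℕ∞) g) : Test d →L[ℂ] Test d where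
  toFun φ := ⟨fun x => χ x * φ (g x), χ.contDiff.mul (φ.contDiff.comp hg),
    χ.hasCompactSupport.mul_right, Set.subset_univ _⟩
  map_add' φ ψ := by ext x; exact mul_add _ _ _
  map_smul' c φ := by ext x; exact mul_left_comm _ c _
  cont := by
    refine continuous_of_continuous_eval
      ⟨⟨fun φ => ⟨fun x => χ x * φ (g x), χ.contDiff.mul (φ.contDiff.comp hg),
        χ.hasCompactSupport.mul_right, Set.subset_univ _⟩, fun φ ψ => ?_⟩, fun c φ => ?_⟩
      (fun x => continuous_const.mul (continuous_eval (g x)))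
      fun K => ⟨⟨tsupport χ, χ.hasCompactSupport⟩, fun φ hφ x hx => ?_⟩
    · ext x; exact mul_add _ _ _
    · ext x; exact mul_left_comm _ c _
    · have : χ x = 0 := image_eq_zero_of_notMem_tsupport hx
      change χ x * φ (g x) = 0
      rw [this, zero_mul]

theorem mulComp_apply (χ : Test d) {g : (Fin d → ℝ) → Fin d → ℝ}
    (hg : ContDiff ℝ ((⊤ : ℕ∞) : WithTop ℕ∞) g) (φ : Test d) (x : Fin d → ℝ) :
    mulComp χ hg φ x = χ x * φ (g x) := rfl

/-- The Dirac distribution at `y`. -/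
noncomputable def dirac (y : Fin d → ℝ) : Distr d :=
  UniformConvergenceCLM.ofFun _ _ _
    (⟨⟨⟨fun φ => φ y, fun _ _ => rfl⟩, fun _ _ => rfl⟩, continuous_eval y⟩ :
      Test d →L[ℂ] ℂ)

theorem dirac_apply (y : Fin d → ℝ) (φ : Test d) : dirac y φ = φ y := rfl

theorem supp_subset {T : Distr d} {K : Set (Fin d → ℝ)} (hK : IsClosed K)
    (h : ∀ φ : Test d, Disjoint (tsupport φ) K → T φ = 0) : supp T ⊆ K := by
  intro x hx
  by_contra hxK
  refine (Distribution.notMem_dsupport_iff x).2 ⟨Kᶜ, fun φ hφ => h φ ?_, hK.isOpen_compl, hxK⟩ hx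
  exact Set.disjoint_left.2 fun z hz => hφ hz

theorem isClosed_supp (T : Distr d) : IsClosed (supp T) := Distribution.isClosed_dsupport

theorem mem_EPrime_of_compact {T : Distr d} {K : Set (Fin d → ℝ)} (hK : IsCompact K)
    (h : ∀ φ : Test d, Disjoint (tsupport φ) K → T φ = 0) : T ∈ EPrime d :=
  hK.of_isClosed_subset (isClosed_supp T) (supp_subset hK.isClosed h)

theorem dirac_apply_eq_zero (y : Fin d → ℝ) (φ : Test d) (h : Disjoint (tsupport φ) {y}) :
    dirac y φ = 0 := by
  rw [dirac_apply]
  exact image_eq_zero_of_notMem_tsupport (Set.disjoint_singleton_right.1 h)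

theorem dirac_mem_EPrime (y : Fin d → ℝ) : dirac y ∈ EPrime d :=
  mem_EPrime_of_compact isCompact_singleton (dirac_apply_eq_zero y)

theorem exists_cutoff {A U : Set (Fin d → ℝ)} (hA : IsCompact A) (hU : IsOpen U) (hAU : A ⊆ U) :
    ∃ χ : Test d, (∀ᶠ x in 𝓝ˢ A, χ x = 1) ∧ tsupport χ ⊆ U := by
  obtain ⟨K, hK, hTK, hKU⟩ := exists_compact_between hA hU hAU
  obtain ⟨χ, h1, h0, -⟩ := exists_contMDiffMap_one_nhds_of_subset_interior (n := (⊤ : ℕ∞))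
    (modelWithCornersSelf ℝ (Fin d → ℝ)) hA.isClosed hTK
  have hsupp : tsupport (fun x => (χ x : ℂ)) ⊆ K := by
    refine closure_minimal (fun x hx => ?_) hK.isClosed
    by_contra hxK
    exact hx (by simp [h0 x hxK])
  refine ⟨⟨fun x => (χ x : ℂ), Complex.ofRealCLM.contDiff.comp χ.contMDiff.contDiff,
    hK.of_isClosed_subset (isClosed_tsupport _) hsupp, by simp⟩, ?_, hsupp.trans hKU⟩
  filter_upwards [h1] with x hx
  change ((χ x : ℝ) : ℂ) = 1
  rw [hx, Complex.ofReal_one]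

theorem pairing_dirac {f : (Fin d → ℝ) → ℂ} (hf : ContDiff ℝ ((⊤ : ℕ∞) : WithTop ℕ∞) f)
    (y : Fin d → ℝ) : pairing (dirac y) f = f y := by
  obtain ⟨χ, hχ, -⟩ := exists_cutoff (isCompact_singleton (x := y)) isOpen_univ
    (Set.subset_univ _)
  rw [pairing_eq (dirac y) f ⟨fun x => χ x * f x, χ.contDiff.mul hf,
    χ.hasCompactSupport.mul_right, Set.subset_univ _⟩, dirac_apply]
  · change χ y * f y = f y
    rw [(hχ.self_of_nhdsSet y rfl : χ y = 1), one_mul]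
  · refine Filter.Eventually.filter_mono (nhdsSet_mono
      (supp_subset isClosed_singleton (dirac_apply_eq_zero y))) ?_
    filter_upwards [hχ] with x hx
    change f x = χ x * f x
    rw [hx, one_mul]

theorem contDiff_mul_right (y : Fin d → ℝ) :
    ContDiff ℝ ((⊤ : ℕ∞) : WithTop ℕ∞) fun x : Fin d → ℝ => x * y :=
  contDiff_id.mul contDiff_const

/-- For $y$ with a zero coordinate $x\mapsto\varphi(xy)$ need not have compact support. The cutoff
repairs this and puts the whole family into one $\mathscr D_K$. -/
theorem pairing_dilate (T : Distr d) {χ : Test d} (hχ : ∀ᶠ x in 𝓝ˢ (supp T), χ x = 1)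
    (φ : Test d) (y : Fin d → ℝ) :
    pairing T (fun x => φ (x * y)) = T (mulComp χ (contDiff_mul_right y) φ) := by
  refine pairing_eq _ _ _ ?_
  filter_upwards [hχ] with x hx
  rw [mulComp_apply, hx, one_mul]

theorem pairing_dilate_of_mem_Rstar (T : Distr d) (φ : Test d) {y : Fin d → ℝ} (hy : y ∈ Rstar d) :
    pairing T (fun x => φ (x * y)) = T (dilate y hy φ) :=
  pairing_eq _ _ _ (Eventually.of_forall fun _ => rfl)

theorem pairing_dilate_eq_zero (T : Distr d) (φ : Test d) (y : Fin d → ℝ)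
    (h : ∀ x ∈ supp T, x * y ∉ tsupport φ) : pairing T (fun x => φ (x * y)) = 0 := by
  rw [pairing_eq T _ 0, map_zero]
  have : {x | x * y ∈ tsupport φ}ᶜ ∈ 𝓝ˢ (supp T) :=
    ((isClosed_tsupport φ).preimage (by fun_prop)).isOpen_compl.mem_nhdsSet.2 h
  filter_upwards [this] with x hx
  exact image_eq_zero_of_notMem_tsupport hx

/-- The restriction of a distribution to `𝓓_K`. -/
noncomputable def restrictIn (T : Distr d) (K : TopologicalSpace.Compacts (Fin d → ℝ)) :
    𝓓_{K}((Fin d → ℝ), ℂ) →L[ℂ] ℂ :=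
  (show Test d →L[ℂ] ℂ from T).comp
    (TestFunction.ofSupportedInCLM ℂ (subset_top (K : Set (Fin d → ℝ))))

/-- If `T` has compact support, then `y ↦ T_x φ(x y)` is smooth. -/
theorem contDiff_pairing_dilate {T : Distr d} (hT : T ∈ EPrime d) (φ : Test d) :
    ContDiff ℝ ((⊤ : ℕ∞) : WithTop ℕ∞) fun y => pairing T fun x => φ (x * y) := by
  obtain ⟨χ, hχ, -⟩ := exists_cutoff hT isOpen_univ (Set.subset_univ _)
  simp only [pairing_dilate T hχ]
  let K : TopologicalSpace.Compacts (Fin d → ℝ) := ⟨tsupport χ, χ.hasCompactSupport⟩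
  have hz : ∀ y, ∀ x ∉ K, mulComp χ (contDiff_mul_right y) φ x = 0 := fun y x hx => by
    rw [mulComp_apply, image_eq_zero_of_notMem_tsupport hx, zero_mul]
  exact ContDiffMapSupportedIn.contDiff_apply_family (restrictIn T K)
    (Ψ := fun p => χ p.2 * φ (p.2 * p.1))
    ((χ.contDiff.comp contDiff_snd).mul (φ.contDiff.comp (contDiff_snd.mul contDiff_fst)))
    (S := fun y => toSupportedIn K (mulComp χ (contDiff_mul_right y) φ) (hz y))
    fun _ _ => rfl

/-- A distribution all of whose dilation functions `y ↦ T_x φ(x y)` have bounded support on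
`(ℝ \ {0})^d` is supported in `(ℝ \ {0})^d`. -/
theorem supp_subset_Rstar (T : Distr d)
    (h : ∀ φ : Test d, ∃ R : ℝ, ∀ (y : Fin d → ℝ) (hy : y ∈ Rstar d), R < ‖y‖ →
      T (dilate y hy φ) = 0) : supp T ⊆ Rstar d := by
  classical
  let K : TopologicalSpace.Compacts (Fin d → ℝ) :=
    ⟨Metric.closedBall 0 1, isCompact_closedBall _ _⟩
  obtain ⟨R, hR⟩ := exists_forall_lt_norm_eq_zero (𝕜 := ℂ) (V := 𝓓_{K}((Fin d → ℝ), ℂ))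
    (Rstar d) (fun y φ => if hy : y ∈ Rstar d then
      T (dilate y hy (TestFunction.ofSupportedIn (subset_top (K : Set (Fin d → ℝ))) φ)) else 0)
    (fun y hy => ⟨(show Test d →L[ℂ] ℂ from T).comp ((dilateCLM y hy).comp
      (TestFunction.ofSupportedInCLM ℂ (subset_top (K : Set (Fin d → ℝ))))), by
        ext φ; simp only [hy, dite_true]; rfl⟩)
    (fun φ => by
      obtain ⟨R, hR⟩ := h (TestFunction.ofSupportedIn (subset_top (K : Set (Fin d → ℝ))) φ)
      exact ⟨R, fun y hy hn => by simp only [hy, dite_true]; exact hR y hy hn⟩)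
  intro x₀ hx₀ j hj
  -- The coordinate $y_j=s$ forces $\|y\|>R$, and the others, $1/r$, shrink the ball of radius $r$
  -- about $0$ into the unit ball. Thus $x\mapsto xy$ maps the neighbourhood $\{|x_j|<1/s\}\cap
  -- B(0,r)$ of $x_0$ into $K$.
  let s : ℝ := |R| + 1
  have hs : 0 < s := by positivity
  let r : ℝ := ‖x₀‖ + 1
  have hr : 0 < r := by positivity
  let y : Fin d → ℝ := Function.update (fun _ => r⁻¹) j s
  have hyj : y j = s := by simp [y]
  have hyi : ∀ i, i ≠ j → y i = r⁻¹ := fun i hi => by simp [y, hi]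
  have hy : y ∈ Rstar d := fun i => by
    by_cases hi : i = j
    · rw [hi, hyj]; exact hs.ne'
    · rw [hyi i hi]; positivity
  have hy' : y⁻¹ ∈ Rstar d := fun i => inv_ne_zero (hy i)
  have hn : R < ‖y‖ := by
    have := norm_le_pi_norm y j
    rw [hyj, Real.norm_of_nonneg hs.le] at this
    have := le_abs_self R
    simp only [s] at *
    linarith
  refine (Distribution.notMem_dsupport_iff x₀).2
    ⟨{x | |x j| < s⁻¹} ∩ Metric.ball 0 r, fun ψ hψ => ?_,
      (isOpen_lt (by fun_prop) continuous_const).inter Metric.isOpen_ball, ?_⟩ hx₀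
  · have hsupp : ∀ x ∉ K, dilate y⁻¹ hy' ψ x = 0 := by
      intro x hx
      by_contra hne
      refine hx ?_
      have hmem := hψ (subset_tsupport _ (show ψ (x * y⁻¹) ≠ 0 from hne))
      change x ∈ Metric.closedBall 0 1
      rw [mem_closedBall_zero_iff, pi_norm_le_iff_of_nonneg zero_le_one]
      intro i
      by_cases hi : i = j
      · have h1 : |(x * y⁻¹) j| < s⁻¹ := hmem.1
        rw [Pi.mul_apply, Pi.inv_apply, hyj, abs_mul, abs_of_pos (inv_pos.2 hs)] at h1
        rw [hi, Real.norm_eq_abs]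
        exact (lt_of_mul_lt_mul_right (by rwa [one_mul]) (inv_pos.2 hs).le).le
      · have h1 : ‖x * y⁻¹‖ < r := by simpa using hmem.2
        have h2 := (norm_le_pi_norm (x * y⁻¹) i).trans_lt h1
        rw [Pi.mul_apply, Pi.inv_apply, hyi i hi, inv_inv, norm_mul, Real.norm_of_nonneg hr.le]
          at h2
        exact (lt_of_mul_lt_mul_right (by rwa [one_mul]) hr.le).le
    have h1 := hR y hy hn (toSupportedIn K (dilate y⁻¹ hy' ψ) hsupp)
    simp only [hy, dite_true, ofSupportedIn_toSupportedIn] at h1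
    rw [← h1]
    congr 1
    ext x
    change ψ x = ψ (x * y * y⁻¹)
    congr 1
    funext i
    simp [hy i]
  · refine ⟨?_, ?_⟩
    · change |x₀ j| < s⁻¹
      rw [hj, abs_zero]; positivity
    · simp [r]

end Hadamard

/-! ### Operators on distributions: density, transposes and eigenvalues. -/

namespace Hadamard

open Filter

variable {d : ℕ}

/-- The transpose of an operator on test functions. -/
noncomputable def transpose (M : Test d →L[ℂ] Test d) : Distr d →L[ℂ] Distr d :=
  M.precompCompactConvergenceCLM ℂ

theorem transpose_apply (M : Test d →L[ℂ] Test d) (S : Distr d) (φ : Test d) :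
    transpose M S φ = S (M φ) := rfl

theorem tendsto_of_forall_isCompact {S : ℕ → Distr d} {S₀ : Distr d}
    (h : ∀ R : ℝ, ∀ᶠ n in atTop, ∀ φ : Test d, (∀ x, R < ‖x‖ → φ x = 0) → S n φ = S₀ φ) :
    Tendsto S atTop (𝓝 S₀) := by
  rw [← tendsto_sub_nhds_zero_iff]
  refine CompactConvergenceCLM.hasBasis_nhds_zero.tendsto_right_iff.2 fun CV hCV => ?_
  obtain ⟨R, hR⟩ := exists_common_support hCV.1
  filter_upwards [h R] with n hn φ hφ
  have : (S n - S₀) φ = S n φ - S₀ φ := rfl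
  rw [this, hn φ (hR φ hφ), sub_self]
  exact mem_of_mem_nhds hCV.2

/-- The cut-off distributions $\chi_nS$ eventually agree with $S$ on every compact set of test
functions, because such a set has a common bounded support. -/
theorem dense_EPrime : Dense (EPrime d) := by
  intro S
  choose χ hχ hχ' using fun n : ℕ =>
    exists_cutoff (isCompact_closedBall (0 : Fin d → ℝ) n) isOpen_univ (Set.subset_univ _)
  refine mem_closure_of_tendsto (b := atTop)
    (f := fun n => transpose (mulComp (χ n) contDiff_id) S)
    (tendsto_of_forall_isCompact fun R => ?_) (Eventually.of_forall fun n => ?_)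
  · obtain ⟨N, hN⟩ := exists_nat_ge R
    filter_upwards [eventually_ge_atTop N] with n hn φ hφ
    rw [transpose_apply]
    congr 1
    ext x
    rw [mulComp_apply, id]
    by_cases hx : R < ‖x‖
    · rw [hφ x hx, mul_zero]
    · have hnN : (N : ℝ) ≤ n := by exact_mod_cast hn
      have : x ∈ Metric.closedBall (0 : Fin d → ℝ) n := by
        rw [mem_closedBall_zero_iff]
        linarith
      rw [((hχ n).self_of_nhdsSet x this : χ n x = 1), one_mul]
  · refine mem_EPrime_of_compact (χ n).hasCompactSupport fun φ hφ => ?_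
    rw [transpose_apply]
    convert map_zero S
    ext x
    rw [mulComp_apply]
    by_cases hx : x ∈ tsupport (χ n)
    · rw [id, image_eq_zero_of_notMem_tsupport (Set.disjoint_right.1 hφ hx), mul_zero]
      rfl
    · rw [image_eq_zero_of_notMem_tsupport hx, zero_mul]
      rfl

/-- A continuous linear functional on the space of distributions vanishes at the Dirac
distributions of all sufficiently distant points. -/
theorem exists_dirac_eq_zero (l : Distr d →L[ℂ] ℂ) : ∃ R : ℝ, ∀ y, R < ‖y‖ → l (dirac y) = 0 := by
  have hl : l ⁻¹' Metric.ball 0 1 ∈ 𝓝 (0 : Distr d) :=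
    l.continuous.continuousAt.preimage_mem_nhds
      (by rw [map_zero]; exact Metric.ball_mem_nhds 0 one_pos)
  obtain ⟨CV, hCV, hsub⟩ := CompactConvergenceCLM.hasBasis_nhds_zero.mem_iff.1 hl
  obtain ⟨R, hR⟩ := exists_common_support hCV.1
  refine ⟨R, fun y hy => ?_⟩
  by_contra hne
  -- Every multiple of $\delta_y$ vanishes on the compact set and so lies in the neighbourhood, yet
  -- $l$ takes the value $1$ at this one.
  have hmem : (l (dirac y))⁻¹ • dirac y ∈ l ⁻¹' Metric.ball 0 1 := hsub fun φ hφ => by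
    have : ((l (dirac y))⁻¹ • dirac y) φ = (l (dirac y))⁻¹ * φ y := rfl
    rw [this, hR φ hφ y hy, mul_zero]
    exact mem_of_mem_nhds hCV.2
  simp [hne] at hmem

theorem supp_subset_Rstar_of_extendsNT {T : Distr d} (hT : T ∈ EPrime d)
    {L : Distr d →L[ℂ] Distr d} (hL : ExtendsNT T L) : supp T ⊆ Rstar d := by
  refine supp_subset_Rstar T fun φ => ?_
  obtain ⟨R, hR⟩ := exists_dirac_eq_zero (⟨⟨⟨fun S => L S φ, fun S S' =>
    congrArg (fun R : Distr d => R φ) (map_add L S S')⟩, fun c S =>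
    congrArg (fun R : Distr d => R φ) (map_smul L c S)⟩,
      (continuous_eval_const φ).comp L.continuous⟩ : Distr d →L[ℂ] ℂ)
  refine ⟨R, fun y hy hn => ?_⟩
  have h1 : L (dirac y) φ = 0 := hR y hn
  rw [hL _ (dirac_mem_EPrime y), NT, pairing_dirac (contDiff_pairing_dilate hT φ),
    pairing_dilate_of_mem_Rstar T φ hy] at h1
  exact h1

theorem supp_subset_Rstar_of_memDH {T : Distr d} (hT : MemDH T) : supp T ⊆ Rstar d := by
  refine supp_subset_Rstar T fun φ => ?_
  obtain ⟨R, hR⟩ := (MT hT φ).hasCompactSupport.isCompact.isBounded.exists_norm_le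
  refine ⟨R, fun y hy hn => ?_⟩
  rw [← MT_apply hT φ y hy]
  exact image_eq_zero_of_notMem_tsupport fun h => hn.not_ge (hR y h)

theorem isCompact_image_div {A B : Set (Fin d → ℝ)} (hA : IsCompact A) (hB : IsCompact B)
    (hBR : B ⊆ Rstar d) : IsCompact ((fun p : (Fin d → ℝ) × (Fin d → ℝ) => p.1 / p.2) '' A ×ˢ B) :=
  (hA.prod hB).image_of_continuousOn <| continuousOn_pi.2 fun j =>
    ContinuousOn.div (by fun_prop) (by fun_prop) fun p hp => hBR hp.2 j

theorem mem_image_div {A B : Set (Fin d → ℝ)} (hBR : B ⊆ Rstar d) {x y : Fin d → ℝ} (hx : x ∈ B)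
    (hxy : x * y ∈ A) : y ∈ (fun p : (Fin d → ℝ) × (Fin d → ℝ) => p.1 / p.2) '' A ×ˢ B :=
  ⟨(x * y, x), ⟨hxy, hx⟩, by funext j; simp [hBR hx j]⟩

/-- The operator `M_T` for a distribution `T` with compact support in `(ℝ \ {0})^d`. -/
theorem exists_clm_eq_pairing {T : Distr d} (hT : T ∈ EPrimeStar d) :
    ∃ M : Test d →L[ℂ] Test d, ∀ φ y, M φ y = pairing T fun x => φ (x * y) := by
  obtain ⟨χ, hχ, -⟩ := exists_cutoff hT.1 isOpen_univ (Set.subset_univ _)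
  have hzero : ∀ (φ : Test d) (y : Fin d → ℝ),
      y ∉ (fun p : (Fin d → ℝ) × (Fin d → ℝ) => p.1 / p.2) '' tsupport φ ×ˢ supp T →
      pairing T (fun x => φ (x * y)) = 0 := fun φ y hy =>
    pairing_dilate_eq_zero T φ y fun x hx h => hy (mem_image_div hT.2 hx h)
  let M : Test d →ₗ[ℂ] Test d :=
    { toFun φ := ⟨fun y => pairing T fun x => φ (x * y), contDiff_pairing_dilate hT.1 φ,
        HasCompactSupport.intro (isCompact_image_div φ.hasCompactSupport hT.1 hT.2)
          (hzero φ), Set.subset_univ _⟩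
      map_add' φ ψ := by
        ext y
        change pairing T (fun x => (φ + ψ) (x * y)) =
          pairing T (fun x => φ (x * y)) + pairing T (fun x => ψ (x * y))
        simp only [pairing_dilate T hχ, map_add]
      map_smul' c φ := by
        ext y
        change pairing T (fun x => (c • φ) (x * y)) = c • pairing T (fun x => φ (x * y))
        simp only [pairing_dilate T hχ, map_smul] }
  have hM : ∀ φ y, M φ y = pairing T fun x => φ (x * y) := fun _ _ => rfl
  refine ⟨⟨M, continuous_of_continuous_eval M (fun y => ?_) fun K => ?_⟩, hM⟩
  · simp only [hM, pairing_dilate T hχ]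
    exact (show Test d →L[ℂ] ℂ from T).continuous.comp
      (mulComp χ (contDiff_mul_right y)).continuous
  · refine ⟨⟨_, isCompact_image_div K.isCompact hT.1 hT.2⟩, fun φ hφ y hy => ?_⟩
    refine hzero φ y fun h => hy (Set.image_mono (Set.prod_mono ?_ subset_rfl) h)
    refine closure_minimal (fun x hx => ?_) K.isCompact.isClosed
    by_contra hxK
    exact hx (hφ x hxK)

theorem transpose_mem_EPrime {T : Distr d} (hT : T ∈ EPrime d) {M : Test d →L[ℂ] Test d}
    (hM : ∀ φ y, M φ y = pairing T fun x => φ (x * y)) {S : Distr d} (hS : S ∈ EPrime d) :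
    transpose M S ∈ EPrime d := by
  -- A compact neighbourhood of the support of $S$ is needed: $M\varphi$ must vanish near that
  -- support, not merely on it.
  obtain ⟨B, hB, hSB, -⟩ := exists_compact_between hS isOpen_univ (Set.subset_univ _)
  refine mem_EPrime_of_compact ((IsCompact.prod hT hB).image
    (f := fun p : (Fin d → ℝ) × (Fin d → ℝ) => p.1 * p.2) (by fun_prop)) fun φ hφ => ?_
  rw [transpose_apply]
  refine apply_eq_zero S _ (Set.disjoint_right.2 fun y hy => ?_)
  rw [notMem_tsupport_iff_eventuallyEq]
  filter_upwards [mem_interior_iff_mem_nhds.1 (hSB hy)] with z hz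
  rw [hM]
  exact pairing_dilate_eq_zero T φ z fun x hx h => Set.disjoint_left.1 hφ h ⟨(x, z), ⟨hx, hz⟩, rfl⟩

theorem MT_eq {T : Distr d} (hT : MemDH T) {M : Test d →L[ℂ] Test d}
    (hM : ∀ φ y, M φ y = pairing T fun x => φ (x * y)) (φ : Test d) : MT hT φ = M φ :=
  DFunLike.coe_injective <| (MT hT φ).continuous.ext_on dense_Rstar (M φ).continuous fun y hy => by
    rw [MT_apply hT φ y hy, hM, pairing_dilate_of_mem_Rstar T φ hy]

/-- Substituting $xy$ for $y$ produces $x^{-\alpha}$ from the monomial and $\prod_j|x_j|^{-1}$ from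
the Jacobian, whence the sign factor $\sigma$. -/
theorem integral_monomial_dilate (α : Fin d → ℕ) (φ : Test d) {x : Fin d → ℝ} (hx : x ∈ Rstar d) :
    ∫ y : Fin d → ℝ, ((∏ j, y j ^ α j : ℝ) : ℂ) * φ (x * y) =
      eigenFun α x * ∫ y : Fin d → ℝ, ((∏ j, y j ^ α j : ℝ) : ℂ) * φ y := by
  have hdet : (Matrix.diagonal x).det ≠ 0 := by
    rw [Matrix.det_diagonal]
    exact Finset.prod_ne_zero_iff.2 fun j _ => hx j
  have hg : Continuous fun y : Fin d → ℝ => ((∏ j, y j ^ α j : ℝ) : ℂ) * φ y := by fun_prop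
  have hmap : Measurable (Matrix.toLin' (Matrix.diagonal x)) :=
    (LinearMap.continuous_on_pi _).measurable
  have happ : ∀ y, Matrix.toLin' (Matrix.diagonal x) y = x * y := fun y => by
    ext j
    simp [Matrix.mulVec_diagonal]
  conv_rhs => rw [← Real.smul_map_diagonal_volume_pi hdet, MeasureTheory.integral_smul_measure,
    MeasureTheory.integral_map hmap.aemeasurable hg.aestronglyMeasurable]
  simp only [happ, Pi.mul_apply, mul_pow, Finset.prod_mul_distrib, Complex.ofReal_mul, mul_assoc]
  rw [MeasureTheory.integral_const_mul, Matrix.det_diagonal, ENNReal.toReal_ofReal (abs_nonneg _),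
    Complex.real_smul]
  have h1 : eigenFun α x * ((|∏ j, x j| : ℝ) * ((∏ j, x j ^ α j : ℝ) : ℂ)) = 1 := by
    rw [eigenFun, ← Complex.ofReal_mul, ← Complex.ofReal_mul, Complex.ofReal_eq_one,
      Finset.abs_prod, ← Finset.prod_div_distrib, ← Finset.prod_mul_distrib,
      ← Finset.prod_mul_distrib]
    refine Finset.prod_eq_one fun j _ => ?_
    have := hx j
    have := abs_ne_zero.2 this
    field_simp
    ring
  rw [← mul_assoc _ _ (∫ _, _), ← mul_assoc, h1, one_mul]

theorem contDiffOn_eigenFun (α : Fin d → ℕ) :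
    ContDiffOn ℝ ((⊤ : ℕ∞) : WithTop ℕ∞) (eigenFun α) (Rstar d) := by
  refine Complex.ofRealCLM.contDiff.comp_contDiffOn ?_
  refine ContDiffOn.div (contDiffOn_prod fun j _ => ?_) (by fun_prop) fun x hx =>
    Finset.prod_ne_zero_iff.2 fun j _ => pow_ne_zero _ (hx j)
  have hj : ContDiffOn ℝ ((⊤ : ℕ∞) : WithTop ℕ∞) (fun x : Fin d → ℝ => x j) (Rstar d) := by fun_prop
  exact hj.div (fun x hx => ContDiffAt.comp_contDiffWithinAt (g := fun t : ℝ => |t|) x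
    (contDiffAt_abs (hx j)) (hj x hx))
    fun x hx => abs_ne_zero.2 (hx j)

/-- The monomials are eigenvectors of the transpose of `M_T`. -/
theorem transpose_monomial {T : Distr d} (hT : T ∈ EPrimeStar d) {M : Test d →L[ℂ] Test d}
    (hM : ∀ φ y, M φ y = pairing T fun x => φ (x * y)) (α : Fin d → ℕ) :
    transpose M (monomial α) = pairing T (eigenFun α) • monomial α := by
  -- Support inside $\mathbb R_*^d$ makes $\chi$ times `eigenFun α` a test function and keeps the
  -- $y$-integration in the compact set $\operatorname{supp}\varphi/\operatorname{supp}\chi$.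
  obtain ⟨χ, hχ, hχR⟩ := exists_cutoff hT.1 isOpen_Rstar hT.2
  have hsm : ContDiff ℝ ((⊤ : ℕ∞) : WithTop ℕ∞) fun x => χ x * eigenFun α x := by
    refine contDiff_iff_contDiffAt.2 fun x => ?_
    by_cases hx : x ∈ tsupport χ
    · exact χ.contDiff.contDiffAt.mul
        ((contDiffOn_eigenFun α).contDiffAt (isOpen_Rstar.mem_nhds (hχR hx)))
    · refine contDiffAt_const (c := 0) |>.congr_of_eventuallyEq ?_
      filter_upwards [notMem_tsupport_iff_eventuallyEq.1 hx] with z hz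
      rw [hz, Pi.zero_apply, zero_mul]
  let ψ : Test d := ⟨_, hsm, χ.hasCompactSupport.mul_right, Set.subset_univ _⟩
  have hψ : ∀ x, ψ x = χ x * eigenFun α x := fun _ => rfl
  have hm : pairing T (eigenFun α) = T ψ := by
    refine pairing_eq _ _ _ ?_
    filter_upwards [hχ] with x hx
    rw [hψ, hx, one_mul]
  ext φ
  let c : ℂ := monomial α φ
  have hr : (pairing T (eigenFun α) • monomial α) φ = T (c • ψ) := by
    rw [map_smul, hm]
    exact mul_comm _ _
  let K : TopologicalSpace.Compacts (Fin d → ℝ) := ⟨tsupport χ, χ.hasCompactSupport⟩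
  have hK : ∀ x ∉ K, χ x = 0 := fun x hx => image_eq_zero_of_notMem_tsupport hx
  let S : (Fin d → ℝ) → Test d := fun y =>
    ((∏ j, y j ^ α j : ℝ) : ℂ) • mulComp χ (contDiff_mul_right y) φ
  have hS : ∀ y x, S y x = ((∏ j, y j ^ α j : ℝ) : ℂ) * (χ x * φ (x * y)) := fun _ _ => rfl
  have hTS : ∀ y, ((∏ j, y j ^ α j : ℝ) : ℂ) * M φ y = T (S y) := fun y => by
    rw [hM, pairing_dilate T hχ, map_smul, smul_eq_mul]
  have hQ := isCompact_image_div φ.hasCompactSupport χ.hasCompactSupport hχR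
  have hQ0 : ∀ y, y ∉ (fun p : (Fin d → ℝ) × (Fin d → ℝ) => p.1 / p.2) ''
      tsupport φ ×ˢ tsupport χ → ∀ x, S y x = 0 := fun y hy x => by
    rw [hS]
    by_cases hx : x ∈ tsupport χ
    · have : x * y ∉ tsupport φ := fun h => hy (mem_image_div hχR hx h)
      rw [image_eq_zero_of_notMem_tsupport this, mul_zero, mul_zero]
    · rw [hK x hx, zero_mul, mul_zero]
  have hSK : ∀ y, ∀ x ∉ K, S y x = 0 := fun y x hx => by rw [hS, hK x hx, zero_mul, mul_zero]
  have hψK : ∀ x ∉ K, (c • ψ) x = 0 := fun x hx => by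
    change c * (χ x * eigenFun α x) = 0
    rw [hK x hx, zero_mul, mul_zero]
  rw [transpose_apply, monomial_apply, hr]
  simp only [hTS]
  have hI := ContDiffMapSupportedIn.integral_apply_family MeasureTheory.volume (restrictIn T K)
    (Ψ := fun p : (Fin d → ℝ) × (Fin d → ℝ) =>
      ((∏ j, p.1 j ^ α j : ℝ) : ℂ) * (χ p.2 * φ (p.2 * p.1)))
    ((Complex.ofRealCLM.contDiff.comp (by fun_prop :
      ContDiff ℝ ((⊤ : ℕ∞) : WithTop ℕ∞) fun p : (Fin d → ℝ) × (Fin d → ℝ) =>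
        ∏ j, p.1 j ^ α j)).mul ((χ.contDiff.comp contDiff_snd).mul
      (φ.contDiff.comp (contDiff_snd.mul contDiff_fst))))
    (S := fun y => toSupportedIn K (S y) (hSK y)) (fun _ _ => rfl) hQ
    (I := toSupportedIn K (c • ψ) hψK) fun x => by
      have h0 := MeasureTheory.setIntegral_eq_integral_of_forall_compl_eq_zero
        (μ := MeasureTheory.volume) fun y hy => hQ0 y hy x
      simp only [hS] at h0
      refine Eq.trans ?_ h0.symm
      change c * (χ x * eigenFun α x) = _
      by_cases hx : x ∈ tsupport χ
      · simp only [mul_left_comm _ (χ x)]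
        rw [MeasureTheory.integral_const_mul, integral_monomial_dilate α φ (hχR hx),
          ← monomial_apply, mul_comm c]
      · simp [hK x hx]
  have h1 : restrictIn T K (toSupportedIn K (c • ψ) hψK) = T (c • ψ) := rfl
  rw [← h1, hI]
  refine (MeasureTheory.setIntegral_eq_integral_of_forall_compl_eq_zero fun y hy => ?_).symm
  have : S y = 0 := by
    ext x
    exact hQ0 y hy x
  change T (S y) = 0
  rw [this, map_zero]

theorem transpose_extendsNT {T : Distr d} {M : Test d →L[ℂ] Test d}
    (hM : ∀ φ y, M φ y = pairing T fun x => φ (x * y)) : ExtendsNT T (transpose M) :=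
  fun S _ φ => (pairing_eq S _ (M φ) (Eventually.of_forall fun y => (hM φ y).symm)).symm

end Hadamard

/-! ### The equivalence and the eigenvalues. -/

open Hadamard in
theorem theorem4p1 (d : ℕ) (T : Distr d) :
    List.TFAE [
      T ∈ EPrime d ∧ ∃ L : Distr d →L[ℂ] Distr d, IsHadamard L ∧ ExtendsNT T L,
      ∃ hT : MemDH T, ∀ S ∈ EPrime d, ∃ R ∈ EPrime d, (R : Test d → ℂ) = LT hT S,
      T ∈ EPrimeStar d] ∧
    (T ∈ EPrimeStar d → ∀ α : Fin d → ℕ,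
      (∀ L : Distr d →L[ℂ] Distr d, IsHadamard L → ExtendsNT T L →
        L (monomial α) = pairing T (eigenFun α) • monomial α) ∧
      (∀ hT : MemDH T, LT hT (monomial α) = ⇑(pairing T (eigenFun α) • monomial α))) := by
  refine ⟨?_, fun hT α => ?_⟩
  · tfae_have 1 → 3 := fun ⟨hT, L, _, hL⟩ => ⟨hT, supp_subset_Rstar_of_extendsNT hT hL⟩
    tfae_have 2 → 3 := by
      rintro ⟨hT, h⟩
      -- $\delta_{\mathbf 1}$ is the unit for $\star$, so its image is $T$ itself.
      obtain ⟨R, hR, hRT⟩ := h _ (dirac_mem_EPrime 1)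
      have hRT' : R = T := DFunLike.coe_injective <| hRT.trans <| funext fun φ => by
        rw [Hadamard.LT, dirac_apply, MT_apply hT φ 1 one_mem_Rstar]
        congr 1
        ext x
        exact congrArg φ (mul_one x)
      exact ⟨hRT' ▸ hR, supp_subset_Rstar_of_memDH hT⟩
    tfae_have 3 → 1 := fun hT => by
      obtain ⟨M, hM⟩ := exists_clm_eq_pairing hT
      exact ⟨hT.1, transpose M, fun α => ⟨_, transpose_monomial hT hM α⟩, transpose_extendsNT hM⟩
    tfae_have 3 → 2 := fun hT => by
      obtain ⟨M, hM⟩ := exists_clm_eq_pairing hT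
      have hDH : MemDH T := fun φ => ⟨M φ, fun y hy => by
        rw [hM, pairing_dilate_of_mem_Rstar T φ hy]⟩
      refine ⟨hDH, fun S hS => ⟨transpose M S, transpose_mem_EPrime hT.1 hM hS, ?_⟩⟩
      funext φ
      rw [Hadamard.LT, MT_eq hDH hM, transpose_apply]
    tfae_finish
  · obtain ⟨M, hM⟩ := exists_clm_eq_pairing hT
    refine ⟨fun L _ hL => ?_, fun hDH => ?_⟩
    · rw [← transpose_monomial hT hM α]
      refine congrFun (L.continuous.ext_on dense_EPrime (transpose M).continuous fun S hS => ?_) _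
      ext φ
      rw [hL S hS φ, transpose_extendsNT hM S hS φ]
    · rw [← transpose_monomial hT hM α]
      funext φ
      rw [Hadamard.LT, MT_eq hDH hM, transpose_apply]
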